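/- For every real $p>3$ there is a constant $c_p>0$, depending only on $p$, with the following property. Let $\delta\in(0,1]$. By a curve of length $1$ we mean an arc $\gamma\subset\mathbb{R}^2$ (the image of $[0,1]$ under an injective continuous map into $\mathbb{R}^2$) with $\mathcal{H}^1(\gamma)=1$, where $\mathcal{H}^1$ denotes one-dimensional Hausdorff measure. Suppose that to every such curve $\gamma$ there are associated an $\mathcal{H}^1$-measurable subset $E_\gamma\subset\gamma$ with $\mathcal{H}^1(E_\gamma)\ge\delta$ and an isometry $\iota_\gamma$ of $\mathbb{R}^2$. Then the union $\bigcup_\gamma \iota_\gamma(E_\gamma)$, taken over all curves $\gamma$ of length $1$, has Lebesgue outer measure at least $c_p\,\delta^p$. -/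

import Mathlib

open MeasureTheory
open scoped MeasureTheory

/-- The Euclidean plane. -/
abbrev Plane : Type := EuclideanSpace ℝ (Fin 2)

/-- A (rectifiable) plane curve of length one, regarded as a point set: an arc, i.e. the image of
`[0, 1]` under an injective continuous map, of one-dimensional Hausdorff measure `1`.
For an arc, `μH[1]` of the point set is the length of the curve, so that rectifiability is
automatic. Curves that retrace themselves are not included (their length is not the `μH[1]`-measure
of the point set, which may be too small to have any subset of length `δ`). -/
def IsUnitLengthCurve (γ : Set Plane) : Prop :=
  (∃ φ : ℝ → Plane, ContinuousOn φ (Set.Icc 0 1) ∧ Set.InjOn φ (Set.Icc 0 1) ∧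
    φ '' Set.Icc 0 1 = γ) ∧
  μH[1] γ = 1

/-- Measurability with respect to the outer measure `ℋ¹` on the plane (Carathéodory). -/
def IsH1Measurable (E : Set Plane) : Prop :=
  (μH[1] : Measure Plane).toOuterMeasure.IsCaratheodory E

/-!
If the union of the copies is small, cover it by an open set `V` of nearly the same measure and
replace `V` by its periodization, so that isometries matter only up to integer translations; at
precision `τ` a finite net of `O(τ⁻⁶)` isometries then suffices.

Start from a segment of length `2`, along whose congruent copies the mean density of `V` in balls
of radius `R` is `O(|V| / R)`. Given a curve, cut it into `N` pieces and shift the `i`-th piece by a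
vector `ω i` of length about `R`. Averaging over `ω i` turns the density of `V` at a small scale `r`
into the density at scale `R`, and choosing the `ω i` greedily against an exponential potential
(a derandomized Chernoff bound) makes this work for all isometries of a net `S` at once, with error
`log |S| / (s N)`. Iterating gives uniformly bi-Lipschitz curves whose limit, by Fatou's lemma,
spends little time in every copy of `V`. The scale `R` may be taken of order `δ² / (1 - log δ)`, so
that `|V| / R` is small compared with `δ` unless `|V|` is at least a constant multiple of
`δ³ / (1 - log δ)`; any exponent above `3` absorbs the logarithm.
-/

open Metric Filter Topology

section BallDensity

variable {X T : Type*} [PseudoMetricSpace X] [MeasurableSpace X] [MeasurableSpace T]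
  {μ : Measure X} {ν : Measure T} {U : Set X} {R : ℝ} {c : T → X}

/-- The proportion of the ball of centre `y` and radius `R` that lies in `U`, which measures how
close `y` is to `U` at the scale `R`; it is `0` when the ball is null or has infinite measure. -/
noncomputable def ballDensity (μ : Measure X) (U : Set X) (R : ℝ) (y : X) : ℝ :=
  μ.real (U ∩ ball y R) / μ.real (ball y R)

lemma ballDensity_nonneg (μ : Measure X) (U : Set X) (R : ℝ) (y : X) :
    0 ≤ ballDensity μ U R y := by
  unfold ballDensity
  positivity

lemma ballDensity_eq_one_of_ball_subset [ProperSpace X] [IsFiniteMeasureOnCompacts μ]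
    [μ.IsOpenPosMeasure] (hR : 0 < R) {y : X} (h : ball y R ⊆ U) : ballDensity μ U R y = 1 := by
  rw [ballDensity, Set.inter_eq_self_of_subset_right h]
  exact div_self (ENNReal.toReal_pos (measure_ball_pos μ y hR).ne' measure_ball_lt_top.ne).ne'

variable [ProperSpace X]

lemma measure_inter_ball_ne_top (μ : Measure X) [IsFiniteMeasureOnCompacts μ] (U : Set X) (y : X)
    (R : ℝ) : μ (U ∩ ball y R) ≠ ⊤ :=
  measure_ne_top_of_subset Set.inter_subset_right measure_ball_lt_top.ne

lemma ballDensity_le_one (μ : Measure X) [IsFiniteMeasureOnCompacts μ] (U : Set X) (R : ℝ)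
    (y : X) : ballDensity μ U R y ≤ 1 :=
  div_le_one_of_le₀ (measureReal_mono Set.inter_subset_right measure_ball_lt_top.ne) (by positivity)

variable [OpensMeasurableSpace X]

lemma measurableSet_mem_inter_ball (hU : MeasurableSet U) (hc : Measurable c) (R : ℝ) :
    MeasurableSet {q : T × X | q.2 ∈ U ∩ ball (c q.1) R} :=
  (measurable_snd hU).inter
    (measurableSet_lt (measurable_snd.dist (hc.comp measurable_fst)) measurable_const)

lemma measurable_measure_inter_ball [SFinite μ] (hU : MeasurableSet U) (hc : Measurable c)
    (R : ℝ) : Measurable fun t => μ (U ∩ ball (c t) R) :=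
  measurable_measure_prodMk_left (measurableSet_mem_inter_ball hU hc R)

lemma measurable_ballDensity [SFinite μ] (hU : MeasurableSet U) (hc : Measurable c) (R : ℝ) :
    Measurable fun t => ballDensity μ U R (c t) := by
  have h (V : Set X) (hV : MeasurableSet V) : Measurable fun t => μ.real (V ∩ ball (c t) R) :=
    (measurable_measure_inter_ball hV hc R).ennreal_toReal
  have hball := h Set.univ MeasurableSet.univ
  simp only [Set.univ_inter] at hball
  exact (h U hU).div hball

lemma lintegral_measure_inter_ball [SFinite μ] [SFinite ν] (hU : MeasurableSet U)
    (hc : Measurable c) (R : ℝ) :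
    ∫⁻ t, μ (U ∩ ball (c t) R) ∂ν = ∫⁻ w in U, ν (c ⁻¹' ball w R) ∂μ := by
  have hS := measurableSet_mem_inter_ball hU hc R
  calc ∫⁻ t, μ (U ∩ ball (c t) R) ∂ν
      = ∫⁻ w, ν {t | w ∈ U ∩ ball (c t) R} ∂μ :=
        (Measure.prod_apply hS).symm.trans (Measure.prod_apply_symm hS)
    _ = ∫⁻ w in U, ν (c ⁻¹' ball w R) ∂μ := by
        rw [← lintegral_indicator hU]
        refine lintegral_congr fun w => ?_
        by_cases hw : w ∈ U <;> simp [hw, Set.preimage, dist_comm w]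

lemma lintegral_measure_inter_ball_le [SFinite μ] [SFinite ν] (hU : MeasurableSet U)
    (hc : Measurable c) {a : X} {R' : ℝ} {C : ENNReal}
    (hball : ∀ᵐ t ∂ν, ball (c t) R ⊆ ball a R') (hC : ∀ w, ν (c ⁻¹' ball w R) ≤ C) :
    ∫⁻ t, μ (U ∩ ball (c t) R) ∂ν ≤ C * μ (U ∩ ball a R') :=
  calc ∫⁻ t, μ (U ∩ ball (c t) R) ∂ν
      ≤ ∫⁻ t, μ (U ∩ ball a R' ∩ ball (c t) R) ∂ν :=
        lintegral_mono_ae <| hball.mono fun _ ht =>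
          measure_mono fun _ hw => ⟨⟨hw.1, ht hw.2⟩, hw.2⟩
    _ = ∫⁻ w in U ∩ ball a R', ν (c ⁻¹' ball w R) ∂μ :=
        lintegral_measure_inter_ball (hU.inter measurableSet_ball) hc R
    _ ≤ ∫⁻ _ in U ∩ ball a R', C ∂μ := lintegral_mono hC
    _ = C * μ (U ∩ ball a R') := setLIntegral_const _ _

lemma lintegral_measure_inter_ball_le_of_antilipschitzWith [SFinite μ] (hU : MeasurableSet U)
    {γ : ℝ → X} (hγ : Measurable γ) {K : NNReal} (hK : AntilipschitzWith K γ) {s : Set ℝ}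
    (hs : MeasurableSet s) {a : X} {R' : ℝ} (hball : ∀ t ∈ s, dist (γ t) a + R ≤ R') :
    ∫⁻ t in s, μ (U ∩ ball (γ t) R) ≤ K * (2 * ENNReal.ofReal R) * μ (U ∩ ball a R') := by
  refine lintegral_measure_inter_ball_le hU hγ
    ((ae_restrict_iff' hs).2 (Eventually.of_forall fun t ht => ball_subset_ball' ?_)) fun w => ?_
  · linarith [hball t ht]
  · calc volume.restrict s (γ ⁻¹' ball w R) ≤ volume (γ ⁻¹' ball w R) :=
          Measure.restrict_apply_le _ _
      _ ≤ ediam (γ ⁻¹' ball w R) := Real.volume_le_diam _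
      _ ≤ K * ediam (ball w R) := hK.ediam_preimage_le _
      _ ≤ K * (2 * ENNReal.ofReal R) := by
          gcongr
          rw [← eball_ofReal]
          exact ediam_eball_le

end BallDensity

section AddHaar

variable {E T : Type*} [NormedAddCommGroup E] [NormedSpace ℝ E] [FiniteDimensional ℝ E]
  [MeasurableSpace E] [BorelSpace E] [MeasurableSpace T] {μ : Measure E} [μ.IsAddHaarMeasure]
  {U : Set E} {R R' : ℝ}

open Module

lemma measureReal_ball_of_pos (μ : Measure E) [μ.IsAddHaarMeasure] (x : E) (hR : 0 < R) :
    μ.real (ball x R) = R ^ finrank ℝ E * μ.real (ball 0 1) := by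
  rw [Measure.real, Measure.addHaar_ball_of_pos μ x hR, ENNReal.toReal_mul,
    ENNReal.toReal_ofReal (by positivity), Measure.real]

lemma ballDensity_le_of_dist_add_le (hR : 0 < R) {y y' : E} (h : dist y y' + R ≤ R') :
    ballDensity μ U R y ≤ (R' / R) ^ finrank ℝ E * ballDensity μ U R' y' := by
  have hR' : 0 < R' := by linarith [dist_nonneg (x := y) (y := y')]
  calc ballDensity μ U R y ≤ μ.real (U ∩ ball y' R') / μ.real (ball y R) := by
        unfold ballDensity
        gcongr ?_ / _
        exact measureReal_mono (Set.inter_subset_inter_right _ (ball_subset_ball' (by linarith)))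
          (measure_inter_ball_ne_top μ U y' R')
    _ = (R' / R) ^ finrank ℝ E * ballDensity μ U R' y' := by
        rw [ballDensity, measureReal_ball_of_pos μ y hR, measureReal_ball_of_pos μ y' hR', div_pow]
        field_simp

lemma integral_ballDensity (ν : Measure T) (hU : MeasurableSet U) (R : ℝ) {c : T → E}
    (hc : Measurable c) :
    ∫ t, ballDensity μ U R (c t) ∂ν =
      (∫⁻ t, μ (U ∩ ball (c t) R) ∂ν).toReal / μ.real (ball 0 R) := by
  simp only [ballDensity, Measure.addHaar_real_ball_center, integral_div]
  congr 1
  exact integral_toReal (measurable_measure_inter_ball hU hc R).aemeasurable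
    (Eventually.of_forall fun _ => (measure_inter_ball_ne_top μ U _ R).lt_top)

lemma setAverage_ballDensity_le (hU : MeasurableSet U) {ρ r : ℝ} (hρ : 0 < ρ) (hr : 0 < r)
    (h : ρ + r ≤ R) (ι : E ≃ᵢ E) (x : E) :
    ⨍ ω in ball 0 ρ, ballDensity μ U r (ι (x + ω)) ∂μ ≤
      (R / ρ) ^ finrank ℝ E * ballDensity μ U R (ι x) := by
  have hc : Measurable fun ω : E => ι (x + ω) :=
    (ι.continuous.comp (continuous_const_add x)).measurable
  have hvol (w : E) : μ.restrict (ball 0 ρ) ((fun ω => ι (x + ω)) ⁻¹' ball w r) ≤ μ (ball 0 r) := by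
    refine (Measure.restrict_apply_le _ _).trans ?_
    change μ ((x + ·) ⁻¹' (ι ⁻¹' ball w r)) ≤ μ (ball 0 r)
    rw [ι.preimage_ball, preimage_add_ball, Measure.addHaar_ball_center]
  have hball : ∀ᵐ ω ∂μ.restrict (ball 0 ρ), ball (ι (x + ω)) r ⊆ ball (ι x) R := by
    refine (ae_restrict_iff' measurableSet_ball).2 (Eventually.of_forall fun ω hω => ?_)
    refine ball_subset_ball' ?_
    rw [mem_ball_zero_iff] at hω
    rw [ι.dist_eq, dist_self_add_left]
    linarith
  have hle := ENNReal.toReal_mono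
    (ENNReal.mul_ne_top measure_ball_lt_top.ne (measure_inter_ball_ne_top μ U (ι x) R))
    (lintegral_measure_inter_ball_le hU hc hball hvol)
  have hr0 : 0 < μ.real (ball (0 : E) r) :=
    ENNReal.toReal_pos (measure_ball_pos μ 0 hr).ne' measure_ball_lt_top.ne
  have hR : 0 < R := by linarith
  calc ⨍ ω in ball 0 ρ, ballDensity μ U r (ι (x + ω)) ∂μ
      ≤ (μ.real (ball 0 ρ))⁻¹ *
          (μ.real (ball 0 r) * μ.real (U ∩ ball (ι x) R) / μ.real (ball 0 r)) := by
        rw [setAverage_eq, integral_ballDensity _ hU r hc, smul_eq_mul]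
        rw [ENNReal.toReal_mul] at hle
        gcongr
        exact hle
    _ = (μ.real (ball 0 ρ))⁻¹ * μ.real (U ∩ ball (ι x) R) := by field_simp
    _ = (R / ρ) ^ finrank ℝ E * ballDensity μ U R (ι x) := by
        rw [ballDensity, measureReal_ball_of_pos μ _ hρ, measureReal_ball_of_pos μ _ hR,
          div_pow]
        field_simp

end AddHaar

section UnitInterval

variable {h : ℝ → ℝ}

lemma intervalIntegrable_of_mem_Icc_zero_one (hm : Measurable h) (h0 : ∀ t, 0 ≤ h t)
    (h1 : ∀ t, h t ≤ 1) (a b : ℝ) : IntervalIntegrable h volume a b := by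
  refine intervalIntegrable_const (c := (1 : ℝ)).mono_fun hm.aestronglyMeasurable
    (Eventually.of_forall fun t => ?_)
  simpa [abs_of_nonneg (h0 t)] using h1 t

lemma intervalIntegral_le_sub (hm : Measurable h) (h0 : ∀ t, 0 ≤ h t) (h1 : ∀ t, h t ≤ 1)
    {a b : ℝ} (hab : a ≤ b) : ∫ t in a..b, h t ≤ b - a := by
  simpa using intervalIntegral.integral_mono_on hab
    (intervalIntegrable_of_mem_Icc_zero_one hm h0 h1 a b) intervalIntegrable_const
    fun t _ => h1 t

end UnitInterval

lemma integral_ballDensity_le_div_of_antilipschitzWith {U : Set Plane} (hU : MeasurableSet U)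
    {R R' M : ℝ} (hR : 0 < R) (hM0 : 0 ≤ M) {a : Plane}
    (hM : volume (U ∩ ball a R') ≤ ENNReal.ofReal M) {γ : ℝ → Plane} (hγ : Measurable γ)
    (hγ1 : AntilipschitzWith 1 γ) (hball : ∀ t ∈ Set.Ioc (0 : ℝ) 1, dist (γ t) a + R ≤ R') :
    ∫ t in (0 : ℝ)..1, ballDensity volume U R (γ t) ≤ M / R := by
  have hle : ∫⁻ t in Set.Ioc (0 : ℝ) 1, volume (U ∩ ball (γ t) R) ≤
      ENNReal.ofReal (2 * R * M) := by
    refine (lintegral_measure_inter_ball_le_of_antilipschitzWith hU hγ hγ1 measurableSet_Ioc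
      hball).trans ?_
    rw [ENNReal.ofReal_mul (by positivity), ENNReal.ofReal_mul zero_le_two, ENNReal.coe_one,
      one_mul, ENNReal.ofReal_ofNat]
    gcongr
  have hball_real : volume.real (ball (0 : Plane) R) = Real.pi * R ^ 2 := by
    rw [Measure.real, EuclideanSpace.volume_ball_fin_two, ENNReal.toReal_mul, ENNReal.toReal_pow,
      ENNReal.toReal_ofReal hR.le]
    simp [mul_comm, Real.pi_nonneg]
  rw [intervalIntegral.integral_of_le zero_le_one, integral_ballDensity _ hU R hγ, hball_real,
    div_le_div_iff₀ (by positivity) hR]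
  have hreal := ENNReal.toReal_le_of_le_ofReal (by positivity) hle
  calc _ ≤ 2 * R * M * R := by gcongr
    _ = M * (2 * R ^ 2) := by ring
    _ ≤ M * (Real.pi * R ^ 2) := by
        gcongr
        exact Real.two_le_pi

section ExponentialPotential

lemma exp_mul_le_one_add {s x : ℝ} (hs : 0 ≤ s) (hs1 : s ≤ 1) (hx : 0 ≤ x) (hx1 : x ≤ 1) :
    Real.exp (s * x) ≤ 1 + s * (1 + s) * x := by
  have hsx : 0 ≤ s * x := mul_nonneg hs hx
  have hexp := (abs_le.1 (Real.abs_exp_sub_one_sub_id_le (x := s * x)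
    (by rw [abs_of_nonneg hsx]; exact mul_le_one₀ hs1 hx hx1))).2
  have hsq : (s * x) ^ 2 ≤ s ^ 2 * x := by
    rw [mul_pow]
    gcongr
    exact pow_le_of_le_one hx hx1 two_ne_zero
  linarith

variable {ι Ω : Type*} [MeasurableSpace Ω] {μ : Measure Ω} {B : Set Ω} {s : ℝ}

lemma exists_sum_mul_exp_le (hB : μ B ≠ 0) (hB' : μ B ≠ ⊤) (S : Finset ι) {w : ι → ℝ}
    (hw : ∀ k, 0 ≤ w k) {X : ι → Ω → ℝ} {m : ι → ℝ} (hs : 0 ≤ s) (hs1 : s ≤ 1)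
    (hX0 : ∀ k ω, 0 ≤ X k ω) (hX1 : ∀ k ω, X k ω ≤ 1) (hXi : ∀ k, IntegrableOn (X k) B μ)
    (hm : ∀ k, ⨍ ω in B, X k ω ∂μ ≤ m k) :
    ∃ ω ∈ B, ∑ k ∈ S, w k * Real.exp (s * (X k ω - (1 + s) * m k)) ≤ ∑ k ∈ S, w k := by
  set c : ι → ℝ := fun k => w k * Real.exp (-(s * (1 + s) * m k))
  have hc (k : ι) : 0 ≤ c k := mul_nonneg (hw k) (Real.exp_pos _).le
  obtain ⟨ω, hωB, hω⟩ := exists_le_setAverage (f := fun ω => ∑ k ∈ S, c k * X k ω) hB hB'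
    (integrable_finsetSum _ fun k _ => (hXi k).const_mul (c k))
  have hmean : ⨍ ω in B, ∑ k ∈ S, c k * X k ω ∂μ ≤ ∑ k ∈ S, c k * m k := by
    rw [setAverage_eq, integral_finsetSum _ fun k _ => (hXi k).const_mul (c k), Finset.smul_sum]
    refine Finset.sum_le_sum fun k _ => ?_
    rw [integral_const_mul, smul_eq_mul, mul_left_comm, ← smul_eq_mul (μ.real B)⁻¹,
      ← setAverage_eq]
    exact mul_le_mul_of_nonneg_left (hm k) (hc k)
  refine ⟨ω, hωB, ?_⟩
  calc ∑ k ∈ S, w k * Real.exp (s * (X k ω - (1 + s) * m k))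
      = ∑ k ∈ S, c k * Real.exp (s * X k ω) :=
        Finset.sum_congr rfl fun k _ => by
          rw [mul_assoc, ← Real.exp_add]
          ring_nf
    _ ≤ ∑ k ∈ S, c k * (1 + s * (1 + s) * X k ω) := by
        gcongr with k
        · exact hc k
        · exact exp_mul_le_one_add hs hs1 (hX0 k ω) (hX1 k ω)
    _ = ∑ k ∈ S, c k + s * (1 + s) * ∑ k ∈ S, c k * X k ω := by
        rw [Finset.mul_sum, ← Finset.sum_add_distrib]
        exact Finset.sum_congr rfl fun k _ => by ring
    _ ≤ ∑ k ∈ S, c k + s * (1 + s) * ∑ k ∈ S, c k * m k := by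
        exact add_le_add_right (mul_le_mul_of_nonneg_left (hω.trans hmean) (by positivity)) _
    _ = ∑ k ∈ S, c k * (s * (1 + s) * m k + 1) := by
        rw [Finset.mul_sum, ← Finset.sum_add_distrib]
        exact Finset.sum_congr rfl fun k _ => by ring
    _ ≤ ∑ k ∈ S, c k * Real.exp (s * (1 + s) * m k) := by
        gcongr with k
        · exact hc k
        · exact Real.add_one_le_exp _
    _ = ∑ k ∈ S, w k :=
        Finset.sum_congr rfl fun k _ => by rw [mul_assoc, ← Real.exp_add, neg_add_cancel,
          Real.exp_zero, mul_one]

variable {X : ℕ → ι → Ω → ℝ} {m : ℕ → ι → ℝ}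

lemma exists_sum_exp_le_card (hB : μ B ≠ 0) (hB' : μ B ≠ ⊤) (S : Finset ι) (hs : 0 ≤ s)
    (hs1 : s ≤ 1) (hX0 : ∀ i k ω, 0 ≤ X i k ω) (hX1 : ∀ i k ω, X i k ω ≤ 1)
    (hXi : ∀ i k, IntegrableOn (X i k) B μ) (hm : ∀ i k, ⨍ ω in B, X i k ω ∂μ ≤ m i k) (N : ℕ) :
    ∃ ω : ℕ → Ω, (∀ i, ω i ∈ B) ∧
      ∑ k ∈ S, Real.exp (s * ∑ i ∈ Finset.range N, (X i k (ω i) - (1 + s) * m i k)) ≤ S.card := by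
  induction N with
  | zero =>
    obtain ⟨b, hb⟩ := nonempty_of_measure_ne_zero hB
    exact ⟨fun _ => b, fun _ => hb, by simp⟩
  | succ N ih =>
    obtain ⟨ω, hω, hsum⟩ := ih
    obtain ⟨x, hxB, hx⟩ := exists_sum_mul_exp_le hB hB' S (fun k => (Real.exp_pos _).le) hs hs1
      (hX0 N) (hX1 N) (hXi N) (hm N)
    refine ⟨Function.update ω N x, fun i => ?_, (Finset.sum_congr rfl fun k _ => ?_).trans_le
      (hx.trans hsum)⟩
    · rcases eq_or_ne i N with rfl | hi
      · rwa [Function.update_self]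
      · rw [Function.update_of_ne hi]
        exact hω i
    · rw [Finset.sum_range_succ, Function.update_self, mul_add, Real.exp_add]
      congr 3
      exact Finset.sum_congr rfl fun i hi => by
        rw [Function.update_of_ne (Finset.mem_range.1 hi).ne]

lemma exists_forall_sum_le (hB : μ B ≠ 0) (hB' : μ B ≠ ⊤) (S : Finset ι) (hs : 0 < s)
    (hs1 : s ≤ 1) (hX0 : ∀ i k ω, 0 ≤ X i k ω) (hX1 : ∀ i k ω, X i k ω ≤ 1)
    (hXi : ∀ i k, IntegrableOn (X i k) B μ) (hm : ∀ i k, ⨍ ω in B, X i k ω ∂μ ≤ m i k) (N : ℕ) :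
    ∃ ω : ℕ → Ω, (∀ i, ω i ∈ B) ∧ ∀ k ∈ S, ∑ i ∈ Finset.range N, X i k (ω i) ≤
      (1 + s) * ∑ i ∈ Finset.range N, m i k + Real.log S.card / s := by
  obtain ⟨ω, hω, h⟩ := exists_sum_exp_le_card hB hB' S hs.le hs1 hX0 hX1 hXi hm N
  refine ⟨ω, hω, fun k hk => ?_⟩
  have hexp : Real.exp (s * ∑ i ∈ Finset.range N, (X i k (ω i) - (1 + s) * m i k)) ≤ S.card :=
    (Finset.single_le_sum (f := fun k => Real.exp
      (s * ∑ i ∈ Finset.range N, (X i k (ω i) - (1 + s) * m i k)))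
      (fun _ _ => (Real.exp_pos _).le) hk).trans h
  have hlog := Real.log_le_log (Real.exp_pos _) hexp
  rw [Real.log_exp, Finset.sum_sub_distrib, ← Finset.mul_sum, ← le_div_iff₀' hs] at hlog
  linarith

end ExponentialPotential

section Plateau

variable {θ x : ℝ}

/-- The trapezoidal cut-off function supported in `[0, 1]` and equal to `1` on `[θ, 1 - θ]`, which
switches a translation of a piece of a curve on and off. -/
noncomputable def plateau (θ x : ℝ) : ℝ :=
  max 0 (min 1 ((1 / 2 - |x - 1 / 2|) / θ))

lemma plateau_nonneg (θ x : ℝ) : 0 ≤ plateau θ x := le_max_left _ _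

lemma plateau_le_one (θ x : ℝ) : plateau θ x ≤ 1 := max_le zero_le_one (min_le_left _ _)

lemma plateau_eq_zero (hθ : 0 ≤ θ) (hx : x ∉ Set.Ioo 0 1) : plateau θ x = 0 := by
  refine max_eq_left ((min_le_right _ _).trans (div_nonpos_of_nonpos_of_nonneg ?_ hθ))
  by_contra! hpos
  obtain ⟨hlower, hupper⟩ := abs_lt.1 (sub_pos.1 hpos)
  exact hx ⟨by linarith, by linarith⟩

lemma plateau_eq_one (hθ : 0 < θ) (hx : x ∈ Set.Icc θ (1 - θ)) : plateau θ x = 1 := by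
  have habs : |x - 1 / 2| ≤ 1 / 2 - θ := abs_le.2 ⟨by linarith [hx.1], by linarith [hx.2]⟩
  rw [plateau, min_eq_left ((one_le_div hθ).2 (by linarith)), max_eq_right zero_le_one]

lemma abs_plateau_sub_le (hθ : 0 ≤ θ) (x y : ℝ) :
    |plateau θ x - plateau θ y| ≤ |x - y| / θ :=
  calc |plateau θ x - plateau θ y|
      ≤ |(1 / 2 - |x - 1 / 2|) / θ - (1 / 2 - |y - 1 / 2|) / θ| :=
        Set.abs_projIcc_sub_projIcc zero_le_one
    _ = |(|y - 1 / 2| - |x - 1 / 2|)| / θ := by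
        rw [← sub_div, sub_sub_sub_cancel_left, abs_div, abs_of_nonneg hθ]
    _ ≤ |x - y| / θ := by
        refine div_le_div_of_nonneg_right ?_ hθ
        rw [abs_sub_comm x y, ← sub_sub_sub_cancel_right y x (1 / 2)]
        exact abs_abs_sub_abs_le_abs_sub _ _

lemma plateau_sub_natCast_eq_zero (hθ : 0 ≤ θ) {i : ℕ} (hi : i ≠ ⌊x⌋₊) :
    plateau θ (x - i) = 0 :=
  plateau_eq_zero hθ fun hx => hi <| Eq.symm <|
    (Nat.floor_eq_iff (by linarith [hx.1, i.cast_nonneg (α := ℝ)])).2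
      ⟨by linarith [hx.1], by linarith [hx.2]⟩

variable {E : Type*} [NormedAddCommGroup E] [NormedSpace ℝ E]

/-- The perturbation which on each interval `[i / N, (i + 1) / N]` with `i < N` is the translation
by `ω i`, cut off near the end points. -/
noncomputable def plateauSum (N : ℕ) (θ : ℝ) (ω : ℕ → E) (t : ℝ) : E :=
  ∑ i ∈ Finset.range N, plateau θ (N * t - i) • ω i

variable {N : ℕ} {ρ : ℝ} {ω : ℕ → E}

lemma continuous_plateauSum (N : ℕ) (θ : ℝ) (ω : ℕ → E) : Continuous (plateauSum N θ ω) := by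
  unfold plateauSum plateau
  fun_prop

lemma plateauSum_eq_ite (hθ : 0 ≤ θ) (N : ℕ) (ω : ℕ → E) (t : ℝ) :
    plateauSum N θ ω t =
      if ⌊N * t⌋₊ < N then plateau θ (N * t - ⌊N * t⌋₊) • ω ⌊N * t⌋₊ else 0 := by
  simp only [← Finset.mem_range]
  rw [← Finset.sum_ite_eq' (Finset.range N) ⌊N * t⌋₊ fun i => plateau θ (N * t - i) • ω i]
  refine Finset.sum_congr rfl fun i _ => ?_
  split_ifs with hi
  · rfl
  · rw [plateau_sub_natCast_eq_zero hθ hi, zero_smul]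

lemma plateauSum_zero (hθ : 0 ≤ θ) (N : ℕ) (ω : ℕ → E) : plateauSum N θ ω 0 = 0 := by
  simp [plateauSum_eq_ite hθ, plateau_eq_zero hθ]

lemma plateauSum_eq (hθ : 0 < θ) (ω : ℕ → E) {i : ℕ} (hi : i < N) {t : ℝ}
    (ht : N * t - i ∈ Set.Icc θ (1 - θ)) : plateauSum N θ ω t = ω i := by
  have hfloor : ⌊N * t⌋₊ = i :=
    (Nat.floor_eq_iff (by linarith [ht.1, i.cast_nonneg (α := ℝ)])).2
      ⟨by linarith [ht.1], by linarith [ht.2]⟩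
  rw [plateauSum_eq_ite hθ.le, hfloor, if_pos hi, plateau_eq_one hθ ht, one_smul]

lemma norm_plateauSum_le (hθ : 0 ≤ θ) (N : ℕ) (hω : ∀ i, ‖ω i‖ ≤ ρ) (t : ℝ) :
    ‖plateauSum N θ ω t‖ ≤ ρ := by
  rw [plateauSum_eq_ite hθ]
  split_ifs
  · rw [norm_smul, Real.norm_of_nonneg (plateau_nonneg _ _)]
    exact (mul_le_of_le_one_left (norm_nonneg _) (plateau_le_one _ _)).trans (hω _)
  · rw [norm_zero]
    exact (norm_nonneg _).trans (hω 0)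

lemma norm_plateauSum_sub_le (hθ : 0 ≤ θ) (N : ℕ) (hω : ∀ i, ‖ω i‖ ≤ ρ) (t u : ℝ) :
    ‖plateauSum N θ ω t - plateauSum N θ ω u‖ ≤ 2 * ρ * N / θ * |t - u| := by
  set a : ℕ → E := fun i => plateau θ (N * t - i) • ω i - plateau θ (N * u - i) • ω i
  have hρ : 0 ≤ ρ := (norm_nonneg _).trans (hω 0)
  have hterm (i : ℕ) : ‖a i‖ ≤ N * |t - u| / θ * ρ := by
    simp only [a, ← sub_smul, norm_smul, Real.norm_eq_abs]
    refine mul_le_mul ((abs_plateau_sub_le hθ _ _).trans_eq ?_) (hω i) (norm_nonneg _)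
      (by positivity)
    rw [sub_sub_sub_cancel_right, ← mul_sub, abs_mul, Nat.abs_cast]
  have hcard : (Finset.range N ∩ {⌊N * t⌋₊, ⌊N * u⌋₊}).card ≤ 2 :=
    (Finset.card_le_card Finset.inter_subset_right).trans Finset.card_le_two
  have hsum : ∑ i ∈ Finset.range N ∩ {⌊N * t⌋₊, ⌊N * u⌋₊}, a i = ∑ i ∈ Finset.range N, a i := by
    refine Finset.sum_subset Finset.inter_subset_left fun i hi hi' => ?_
    simp only [Finset.mem_inter, hi, true_and, Finset.mem_insert, Finset.mem_singleton,
      not_or] at hi'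
    simp only [a, plateau_sub_natCast_eq_zero hθ hi'.1, plateau_sub_natCast_eq_zero hθ hi'.2,
      zero_smul, sub_zero]
  calc ‖plateauSum N θ ω t - plateauSum N θ ω u‖
      = ‖∑ i ∈ Finset.range N ∩ {⌊N * t⌋₊, ⌊N * u⌋₊}, a i‖ := by
        rw [hsum, plateauSum, plateauSum, ← Finset.sum_sub_distrib]
    _ ≤ (Finset.range N ∩ {⌊N * t⌋₊, ⌊N * u⌋₊}).card • (N * |t - u| / θ * ρ) :=
        (norm_sum_le _ _).trans (Finset.sum_le_card_nsmul _ _ _ fun i _ => hterm i)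
    _ ≤ 2 • (N * |t - u| / θ * ρ) := nsmul_le_nsmul_left (by positivity) hcard
    _ = 2 * ρ * N / θ * |t - u| := by
        rw [two_nsmul]
        ring

end Plateau

section Perturbation

lemma integral_le_integral_add_of_eqOn {h k : ℝ → ℝ} (hh : Measurable h) (hh0 : ∀ t, 0 ≤ h t)
    (hh1 : ∀ t, h t ≤ 1) (hk : Measurable k) (hk0 : ∀ t, 0 ≤ k t) (hk1 : ∀ t, k t ≤ 1)
    {a b ε : ℝ} (hε : 0 ≤ ε) (hab : a + ε ≤ b - ε)
    (heq : Set.EqOn h k (Set.Icc (a + ε) (b - ε))) :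
    ∫ t in a..b, h t ≤ (∫ t in a..b, k t) + 2 * ε := by
  have hint := intervalIntegrable_of_mem_Icc_zero_one hh hh0 hh1
  have hleft := intervalIntegral_le_sub hh hh0 hh1 (show a ≤ a + ε by linarith)
  have hright := intervalIntegral_le_sub hh hh0 hh1 (show b - ε ≤ b by linarith)
  have hmiddle : ∫ t in (a + ε)..(b - ε), h t ≤ ∫ t in a..b, k t := by
    rw [intervalIntegral.integral_congr (by rwa [Set.uIcc_of_le hab])]
    exact intervalIntegral.integral_mono_interval (by linarith) hab (by linarith)
      (Eventually.of_forall hk0) (intervalIntegrable_of_mem_Icc_zero_one hk hk0 hk1 _ _)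
  calc ∫ t in a..b, h t
      = (∫ t in a..(a + ε), h t) + (∫ t in (a + ε)..(b - ε), h t) + ∫ t in (b - ε)..b, h t := by
        rw [intervalIntegral.integral_add_adjacent_intervals (hint _ _) (hint _ _),
          intervalIntegral.integral_add_adjacent_intervals (hint _ _) (hint _ _)]
    _ ≤ (∫ t in a..b, k t) + 2 * ε := by linarith

lemma sum_integral_div_natCast {h : ℝ → ℝ} (hh : ∀ a b, IntervalIntegrable h volume a b) {N : ℕ}
    (hN : 0 < N) :
    ∑ i ∈ Finset.range N, ∫ t in (i / N : ℝ)..((i + 1) / N), h t = ∫ t in (0 : ℝ)..1, h t := by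
  have hsum := intervalIntegral.sum_integral_adjacent_intervals (f := h)
    (a := fun i : ℕ => (i / N : ℝ)) (n := N) fun _ _ => hh _ _
  simpa [Nat.cast_ne_zero.2 hN.ne'] using hsum

section Averaging

variable {Ω : Type*} [MeasurableSpace Ω] {μ : Measure Ω} {B : Set Ω} {Φ : ℝ → Ω → ℝ} {a b : ℝ}

lemma integrable_uncurry_restrict_prod (hB : μ B ≠ ⊤) (hΦ : Measurable (Function.uncurry Φ))
    (h0 : ∀ t ω, 0 ≤ Φ t ω) (h1 : ∀ t ω, Φ t ω ≤ 1) (a b : ℝ) :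
    Integrable (Function.uncurry Φ)
      ((volume.restrict (Set.uIoc a b)).prod (μ.restrict B)) := by
  have : IsFiniteMeasure (μ.restrict B) := isFiniteMeasure_restrict.2 hB
  have : IsFiniteMeasure (volume.restrict (Set.uIoc a b)) := ⟨by simp⟩
  exact Integrable.of_bound hΦ.aestronglyMeasurable 1 <| Eventually.of_forall fun q =>
    (Real.norm_of_nonneg (h0 q.1 q.2)).trans_le (h1 q.1 q.2)

lemma integrableOn_intervalIntegral (hB : μ B ≠ ⊤) (hΦ : Measurable (Function.uncurry Φ))
    (h0 : ∀ t ω, 0 ≤ Φ t ω) (h1 : ∀ t ω, Φ t ω ≤ 1) (hab : a ≤ b) :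
    IntegrableOn (fun ω => ∫ t in a..b, Φ t ω) B μ := by
  have : IsFiniteMeasure (μ.restrict B) := isFiniteMeasure_restrict.2 hB
  simp only [intervalIntegral.integral_of_le hab, ← Set.uIoc_of_le hab]
  exact (integrable_uncurry_restrict_prod hB hΦ h0 h1 a b).integral_prod_right

lemma setAverage_intervalIntegral_le (hB : μ B ≠ ⊤) (hΦ : Measurable (Function.uncurry Φ))
    (h0 : ∀ t ω, 0 ≤ Φ t ω) (h1 : ∀ t ω, Φ t ω ≤ 1) {g : ℝ → ℝ}
    (hg : IntervalIntegrable g volume a b) (hΦg : ∀ t, ⨍ ω in B, Φ t ω ∂μ ≤ g t) (hab : a ≤ b) :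
    ⨍ ω in B, (∫ t in a..b, Φ t ω) ∂μ ≤ ∫ t in a..b, g t := by
  have : IsFiniteMeasure (μ.restrict B) := isFiniteMeasure_restrict.2 hB
  have hint := integrable_uncurry_restrict_prod hB hΦ h0 h1 a b
  simp only [setAverage_eq, smul_eq_mul] at hΦg ⊢
  rw [← intervalIntegral_integral_swap hint, ← intervalIntegral.integral_const_mul]
  exact intervalIntegral.integral_mono_on hab
    ((intervalIntegrable_iff.2 hint.integral_prod_left).const_mul _) hg fun t _ => hΦg t

end Averaging

variable {ι E : Type*} [NormedAddCommGroup E] [SecondCountableTopology E] [MeasurableSpace E]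
  [BorelSpace E] {f : ℝ → E} {N : ℕ} {μ : Measure E} {B : Set E} {F G : ι → E → ℝ} {s : ℝ}

lemma exists_forall_sum_integral_add_le (hB : μ B ≠ 0) (hB' : μ B ≠ ⊤) (S : Finset ι)
    (hF : ∀ k, Measurable (F k)) (hF0 : ∀ k x, 0 ≤ F k x) (hF1 : ∀ k x, F k x ≤ 1)
    (hf : Measurable f) (hG : ∀ k a b, IntervalIntegrable (fun t => G k (f t)) volume a b)
    (hFG : ∀ k x, ⨍ ω in B, F k (x + ω) ∂μ ≤ G k x) (hN : 0 < N) (hs : 0 < s) (hs1 : s ≤ 1) :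
    ∃ ω : ℕ → E, (∀ i, ω i ∈ B) ∧ ∀ k ∈ S,
      ∑ i ∈ Finset.range N, ∫ t in (i / N : ℝ)..((i + 1) / N), F k (f t + ω i) ≤
        (1 + s) * (∫ t in (0 : ℝ)..1, G k (f t)) + Real.log S.card / (s * N) := by
  have hN' : (0 : ℝ) < N := Nat.cast_pos.2 hN
  have hpiece (i : ℕ) : (i / N : ℝ) ≤ (i + 1) / N := by gcongr; linarith
  have hΦ (k : ι) : Measurable (Function.uncurry fun t ω => F k (f t + ω)) :=
    (hF k).comp ((hf.comp measurable_fst).add measurable_snd)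
  set X : ℕ → ι → E → ℝ := fun i k ω => N * ∫ t in (i / N : ℝ)..((i + 1) / N), F k (f t + ω)
  set m : ℕ → ι → ℝ := fun i k => N * ∫ t in (i / N : ℝ)..((i + 1) / N), G k (f t)
  have hX0 (i : ℕ) (k : ι) (ω : E) : 0 ≤ X i k ω :=
    mul_nonneg hN'.le (intervalIntegral.integral_nonneg (hpiece i) fun _ _ => hF0 _ _)
  have hX1 (i : ℕ) (k : ι) (ω : E) : X i k ω ≤ 1 := by
    have hlength := intervalIntegral_le_sub ((hF k).comp (hf.add_const ω)) (fun _ => hF0 _ _)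
      (fun _ => hF1 _ _) (hpiece i)
    rw [← sub_div, add_sub_cancel_left] at hlength
    exact (mul_le_mul_of_nonneg_left hlength hN'.le).trans_eq (mul_one_div_cancel hN'.ne')
  have hXi (i : ℕ) (k : ι) : IntegrableOn (X i k) B μ :=
    (integrableOn_intervalIntegral hB' (hΦ k) (fun _ _ => hF0 _ _) (fun _ _ => hF1 _ _)
      (hpiece i)).const_mul _
  have hXm (i : ℕ) (k : ι) : ⨍ ω in B, X i k ω ∂μ ≤ m i k := by
    have hmean := setAverage_intervalIntegral_le hB' (hΦ k) (fun _ _ => hF0 _ _)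
      (fun _ _ => hF1 _ _) (hG k _ _) (fun t => hFG k (f t)) (hpiece i)
    simp only [setAverage_eq, smul_eq_mul, X, integral_const_mul] at hmean ⊢
    rw [mul_left_comm]
    exact mul_le_mul_of_nonneg_left hmean hN'.le
  obtain ⟨ω, hω, hle⟩ := exists_forall_sum_le hB hB' S hs hs1 hX0 hX1 hXi hXm N
  refine ⟨ω, hω, fun k hk => ?_⟩
  have hsum := hle k hk
  rw [← Finset.mul_sum, ← Finset.mul_sum, sum_integral_div_natCast (hG k) hN] at hsum
  refine le_of_mul_le_mul_left (hsum.trans_eq ?_) hN'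
  field_simp

variable [NormedSpace ℝ E] {θ : ℝ}

lemma integral_add_plateauSum_le {F : E → ℝ} (hF : Measurable F) (hF0 : ∀ x, 0 ≤ F x)
    (hF1 : ∀ x, F x ≤ 1) (hf : Measurable f) (hθ : 0 < θ) (hθ1 : θ ≤ 1 / 2) (ω : ℕ → E)
    {i : ℕ} (hi : i < N) :
    ∫ t in (i / N : ℝ)..((i + 1) / N), F (f t + plateauSum N θ ω t) ≤
      (∫ t in (i / N : ℝ)..((i + 1) / N), F (f t + ω i)) + 2 * (θ / N) := by
  have hN : (0 : ℝ) < N := Nat.cast_pos.2 (by lia)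
  refine integral_le_integral_add_of_eqOn
    (hF.comp (hf.add (continuous_plateauSum N θ ω).measurable)) (fun _ => hF0 _) (fun _ => hF1 _)
    (hF.comp (hf.add_const _)) (fun _ => hF0 _) (fun _ => hF1 _) (by positivity) ?_ fun t ht => ?_
  · rw [← add_div, ← sub_div]
    gcongr
    linarith
  · obtain ⟨hlower, hupper⟩ := ht
    rw [← add_div, div_le_iff₀ hN] at hlower
    rw [← sub_div, le_div_iff₀ hN] at hupper
    exact congrArg (fun v => F (f t + v))
      (plateauSum_eq hθ ω hi ⟨by linarith, by linarith⟩)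

lemma exists_forall_integral_add_plateauSum_le (hB : μ B ≠ 0) (hB' : μ B ≠ ⊤) (S : Finset ι)
    (hF : ∀ k, Measurable (F k)) (hF0 : ∀ k x, 0 ≤ F k x) (hF1 : ∀ k x, F k x ≤ 1)
    (hf : Measurable f) (hG : ∀ k a b, IntervalIntegrable (fun t => G k (f t)) volume a b)
    (hFG : ∀ k x, ⨍ ω in B, F k (x + ω) ∂μ ≤ G k x) (hN : 0 < N) (hθ : 0 < θ) (hθ1 : θ ≤ 1 / 2)
    (hs : 0 < s) (hs1 : s ≤ 1) :
    ∃ ω : ℕ → E, (∀ i, ω i ∈ B) ∧ ∀ k ∈ S,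
      ∫ t in (0 : ℝ)..1, F k (f t + plateauSum N θ ω t) ≤
        (1 + s) * (∫ t in (0 : ℝ)..1, G k (f t)) + Real.log S.card / (s * N) + 2 * θ := by
  obtain ⟨ω, hω, hle⟩ := exists_forall_sum_integral_add_le hB hB' S hF hF0 hF1 hf hG hFG hN hs hs1
  refine ⟨ω, hω, fun k hk => ?_⟩
  have hg : Measurable fun t => F k (f t + plateauSum N θ ω t) :=
    (hF k).comp (hf.add (continuous_plateauSum N θ ω).measurable)
  calc ∫ t in (0 : ℝ)..1, F k (f t + plateauSum N θ ω t)
      = ∑ i ∈ Finset.range N,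
          ∫ t in (i / N : ℝ)..((i + 1) / N), F k (f t + plateauSum N θ ω t) :=
        (sum_integral_div_natCast (intervalIntegrable_of_mem_Icc_zero_one hg (fun _ => hF0 _ _)
          fun _ => hF1 _ _) hN).symm
    _ ≤ ∑ i ∈ Finset.range N,
          ((∫ t in (i / N : ℝ)..((i + 1) / N), F k (f t + ω i)) + 2 * (θ / N)) :=
        Finset.sum_le_sum fun i hi => integral_add_plateauSum_le (hF k) (hF0 k) (hF1 k) hf hθ hθ1 ω
          (Finset.mem_range.1 hi)
    _ = (∑ i ∈ Finset.range N, ∫ t in (i / N : ℝ)..((i + 1) / N), F k (f t + ω i)) + 2 * θ := by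
        rw [Finset.sum_add_distrib, Finset.sum_const, Finset.card_range, nsmul_eq_mul]
        field_simp
    _ ≤ (1 + s) * (∫ t in (0 : ℝ)..1, G k (f t)) + Real.log S.card / (s * N) + 2 * θ := by
        gcongr
        exact hle k hk

end Perturbation

section Lattice

variable {κ : Type*}

/-- The integer vectors of the standard lattice in Euclidean space, as a homomorphism. -/
noncomputable def latticeVec : (κ → ℤ) →+ EuclideanSpace ℝ κ :=
  AddMonoidHom.mk' (fun z => WithLp.toLp 2 fun i => (z i : ℝ)) fun z z' => by ext i; simp

@[simp]
lemma latticeVec_apply (z : κ → ℤ) (i : κ) : latticeVec z i = z i := rfl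

/-- Invariance under integer translations, so that the set comes from a subset of the torus. -/
def IsLatticePeriodic (U : Set (EuclideanSpace ℝ κ)) : Prop :=
  ∀ (z : κ → ℤ) (x : EuclideanSpace ℝ κ), x + latticeVec z ∈ U ↔ x ∈ U

/-- The union of all integer translates of a set, which makes it periodic at a bounded cost in
measure per ball. -/
def periodization (V : Set (EuclideanSpace ℝ κ)) : Set (EuclideanSpace ℝ κ) :=
  ⋃ z : κ → ℤ, (· + latticeVec z) ⁻¹' V

variable {V : Set (EuclideanSpace ℝ κ)}

lemma subset_periodization (V : Set (EuclideanSpace ℝ κ)) : V ⊆ periodization V :=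
  fun x hx => Set.mem_iUnion.2 ⟨0, by simpa using hx⟩

lemma isLatticePeriodic_periodization (V : Set (EuclideanSpace ℝ κ)) :
    IsLatticePeriodic (periodization V) := by
  intro z x
  simp only [periodization, Set.mem_iUnion, Set.mem_preimage, add_assoc, ← map_add]
  exact (Equiv.addLeft z).exists_congr_left.trans (by simp)

lemma isOpen_periodization [Finite κ] (hV : IsOpen V) : IsOpen (periodization V) := by
  cases nonempty_fintype κ
  exact isOpen_iUnion fun _ => hV.preimage (continuous_add_const _)

variable [Fintype κ]

lemma ballDensity_add_latticeVec {U : Set (EuclideanSpace ℝ κ)} (hU : IsLatticePeriodic U) (R : ℝ)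
    (y : EuclideanSpace ℝ κ) (z : κ → ℤ) :
    ballDensity volume U R (y + latticeVec z) = ballDensity volume U R y := by
  have hpre : (· + latticeVec z) ⁻¹' (U ∩ ball (y + latticeVec z) R) = U ∩ ball y R := by
    ext x
    simp [hU z x]
  rw [ballDensity, ballDensity, ← hpre, Measure.addHaar_real_ball_center _ (y + _),
    Measure.addHaar_real_ball_center _ y, measureReal_def, measureReal_def (s := _ ⁻¹' _),
    measure_preimage_add_right]

lemma card_Icc_ceil_floor_le (c : ℝ) (r : ℕ) : (Finset.Icc ⌈c - r⌉ ⌊c + r⌋).card ≤ 2 * r + 1 := by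
  have hle : ⌊c + r⌋ ≤ ⌈c - r⌉ + 2 * r := by
    exact_mod_cast (show (⌊c + r⌋ : ℝ) ≤ ⌈c - r⌉ + 2 * r by
      linarith [Int.floor_le (c + r), Int.le_ceil (c - r)])
  rw [Int.card_Icc]
  lia

lemma count_preimage_ball_add_latticeVec_le (a w : EuclideanSpace ℝ κ) (r : ℕ) :
    Measure.count ((fun z : κ → ℤ => a + latticeVec z) ⁻¹' ball w r) ≤
      (2 * r + 1) ^ Fintype.card κ := by
  classical
  set C : Finset (κ → ℤ) := Fintype.piFinset fun i => Finset.Icc ⌈w i - a i - r⌉ ⌊w i - a i + r⌋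
  have hsubset : (fun z : κ → ℤ => a + latticeVec z) ⁻¹' ball w r ⊆ C := by
    intro z hz
    rw [Finset.mem_coe, Fintype.mem_piFinset]
    intro i
    rw [Set.mem_preimage, mem_ball_iff_norm] at hz
    have hi := abs_lt.1 ((PiLp.norm_apply_le (a + latticeVec z - w) i).trans_lt hz)
    simp only [PiLp.sub_apply, PiLp.add_apply, latticeVec_apply] at hi
    rw [Finset.mem_Icc, Int.ceil_le, Int.le_floor]
    constructor <;> linarith
  have hcard : C.card ≤ (2 * r + 1) ^ Fintype.card κ := by
    rw [Fintype.card_piFinset]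
    exact Finset.prod_le_pow_card _ _ _ fun i _ => card_Icc_ceil_floor_le _ r
  refine (measure_mono hsubset).trans ?_
  rw [Measure.count_apply_finset]
  exact_mod_cast hcard

lemma volume_periodization_inter_ball_le (hV : MeasurableSet V) (a : EuclideanSpace ℝ κ) (r : ℕ) :
    volume (periodization V ∩ ball a r) ≤ (2 * r + 1) ^ Fintype.card κ * volume V := by
  have hunion : periodization V ∩ ball a r =
      ⋃ z : κ → ℤ, (· + latticeVec z) ⁻¹' (V ∩ ball (a + latticeVec z) r) := by
    rw [periodization, Set.iUnion_inter]
    refine Set.iUnion_congr fun z => ?_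
    ext x
    simp
  calc volume (periodization V ∩ ball a r)
      ≤ ∑' z : κ → ℤ, volume ((· + latticeVec z) ⁻¹' (V ∩ ball (a + latticeVec z) r)) := by
        rw [hunion]
        exact measure_iUnion_le _
    _ = ∫⁻ z : κ → ℤ, volume (V ∩ ball (a + latticeVec z) r) ∂Measure.count := by
        simp only [measure_preimage_add_right, lintegral_count]
    _ = ∫⁻ w in V, Measure.count ((fun z : κ → ℤ => a + latticeVec z) ⁻¹' ball w r) :=
        lintegral_measure_inter_ball hV (measurable_of_countable _) r
    _ ≤ ∫⁻ _ in V, (2 * r + 1) ^ Fintype.card κ :=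
        lintegral_mono fun w => count_preimage_ball_add_latticeVec_le a w r
    _ = (2 * r + 1) ^ Fintype.card κ * volume V := setLIntegral_const _ _

end Lattice

section IsometryNet

lemma exists_finset_forall_abs_sub_le {α β : Type*} [Fintype β] {Φ : α → β → ℝ}
    (hΦ : ∀ a q, |Φ a q| ≤ 1) {K : ℕ} (hK : 0 < K) :
    ∃ S : Finset α, S.card ≤ (2 * K + 1) ^ Fintype.card β ∧
      ∀ a, ∃ a' ∈ S, ∀ q, |Φ a q - Φ a' q| ≤ 1 / K := by
  classical
  have hK' : (0 : ℝ) < K := Nat.cast_pos.2 hK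
  set code : α → β → ℤ := fun a q => ⌊K * Φ a q⌋
  have hcode (a : α) :
      code a ∈ Fintype.piFinset fun _ : β => Finset.Icc ⌈(0 - K : ℝ)⌉ ⌊(0 + K : ℝ)⌋ := by
    refine Fintype.mem_piFinset.2 fun q => Finset.mem_Icc.2 ⟨?_, Int.floor_le_floor ?_⟩
    · have := (abs_le.1 (hΦ a q)).1
      rw [zero_sub, Int.ceil_neg, Int.floor_natCast, Int.le_floor]
      push_cast
      nlinarith
    · have := (abs_le.1 (hΦ a q)).2
      nlinarith
  obtain ⟨s, -, hs⟩ := Set.exists_subset_bijOn Set.univ code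
  have hfinite : s.Finite :=
    Set.Finite.of_injOn (fun a _ => hcode a) hs.injOn (Finset.finite_toSet _)
  refine ⟨hfinite.toFinset, ?_, fun a => ?_⟩
  · refine (Finset.card_le_card_of_injOn code (fun a _ => hcode a)
      (by simpa using hs.injOn)).trans ?_
    rw [Fintype.card_piFinset]
    exact Finset.prod_le_pow_card _ _ _ fun i _ => card_Icc_ceil_floor_le _ K
  · obtain ⟨a', ha's, ha'⟩ := hs.surjOn ⟨a, Set.mem_univ a, rfl⟩
    refine ⟨a', hfinite.mem_toFinset.2 ha's, fun q => ?_⟩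
    have hfloor := (Int.abs_sub_lt_one_of_floor_eq_floor (congrFun ha' q).symm).le
    rw [← mul_sub, abs_mul, Nat.abs_cast] at hfloor
    rwa [le_div_iff₀' hK']

variable {κ : Type*} [Fintype κ]

lemma norm_le_card_mul_of_abs_apply_le {v : EuclideanSpace ℝ κ} {ε : ℝ} (hv : ∀ j, |v j| ≤ ε) :
    ‖v‖ ≤ Fintype.card κ * ε := by
  classical
  rw [← (EuclideanSpace.basisFun κ ℝ).sum_repr v, ← nsmul_eq_mul]
  refine (norm_sum_le_of_le _ fun j _ => ?_).trans
    (Finset.sum_le_card_nsmul _ (fun j => |v j|) _ fun j _ => hv j)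
  simp [norm_smul]

section Data

variable [DecidableEq κ]

lemma isometryEquiv_apply_eq_add_sum (ι : EuclideanSpace ℝ κ ≃ᵢ EuclideanSpace ℝ κ)
    (x : EuclideanSpace ℝ κ) :
    ι x = ι 0 + ∑ i, x i • (ι (EuclideanSpace.single i 1) - ι 0) := by
  have hlinear (y : EuclideanSpace ℝ κ) :
      ι y - ι 0 = ι.toRealAffineIsometryEquiv.linearIsometryEquiv y := by
    have hvadd := ι.toRealAffineIsometryEquiv.map_vadd 0 y
    rw [IsometryEquiv.coeFn_toRealAffineIsometryEquiv, vadd_eq_add, vadd_eq_add, add_zero] at hvadd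
    rw [hvadd, add_sub_cancel_right]
  have hx : x = ∑ i, x i • EuclideanSpace.single i (1 : ℝ) := by
    simpa using ((EuclideanSpace.basisFun κ ℝ).sum_repr x).symm
  simp only [hlinear, ← map_smul, ← map_sum]
  rw [← hx, ← hlinear, add_sub_cancel]

/-- Finitely many bounded numbers which determine an isometry up to an integer translation: the
image of the origin modulo the lattice and the columns of the linear part. -/
noncomputable def isometryData (ι : EuclideanSpace ℝ κ ≃ᵢ EuclideanSpace ℝ κ) :
    Option κ × κ → ℝ
  | (none, j) => Int.fract (ι 0 j)
  | (some i, j) => (ι (EuclideanSpace.single i 1) - ι 0) j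

lemma abs_isometryData_le_one (ι : EuclideanSpace ℝ κ ≃ᵢ EuclideanSpace ℝ κ) :
    ∀ q, |isometryData ι q| ≤ 1
  | (none, j) => (abs_of_nonneg (Int.fract_nonneg (ι 0 j))).trans_le (Int.fract_lt_one _).le
  | (some i, j) => by
    refine (PiLp.norm_apply_le (ι (EuclideanSpace.single i 1) - ι 0) j).trans ?_
    rw [← dist_eq_norm, ι.dist_eq, dist_zero_right, PiLp.norm_single, norm_one]

lemma exists_dist_add_latticeVec_le {ι ι' : EuclideanSpace ℝ κ ≃ᵢ EuclideanSpace ℝ κ} {ε : ℝ}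
    (h : ∀ q, |isometryData ι q - isometryData ι' q| ≤ ε) :
    ∃ z : κ → ℤ, ∀ x, dist (ι x + latticeVec z) (ι' x) ≤
      Fintype.card κ * ε * (1 + Fintype.card κ * ‖x‖) := by
  set v : κ → EuclideanSpace ℝ κ := fun i => ι (EuclideanSpace.single i 1) - ι 0
  set v' : κ → EuclideanSpace ℝ κ := fun i => ι' (EuclideanSpace.single i 1) - ι' 0
  refine ⟨fun j => ⌊ι' 0 j⌋ - ⌊ι 0 j⌋, fun x => ?_⟩
  set o : EuclideanSpace ℝ κ := ι 0 + latticeVec (fun j => ⌊ι' 0 j⌋ - ⌊ι 0 j⌋) - ι' 0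
  have ho : ‖o‖ ≤ Fintype.card κ * ε := norm_le_card_mul_of_abs_apply_le fun j => by
    convert h (none, j) using 2
    change ι 0 j + ((⌊ι' 0 j⌋ - ⌊ι 0 j⌋ : ℤ) : ℝ) - ι' 0 j = Int.fract (ι 0 j) - Int.fract (ι' 0 j)
    rw [Int.fract, Int.fract]
    push_cast
    ring
  have hv (i : κ) : ‖v i - v' i‖ ≤ Fintype.card κ * ε :=
    norm_le_card_mul_of_abs_apply_le fun j => h (some i, j)
  have hterm (i : κ) : ‖x i • (v i - v' i)‖ ≤ ‖x‖ * (Fintype.card κ * ε) := by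
    rw [norm_smul]
    exact mul_le_mul (PiLp.norm_apply_le x i) (hv i) (norm_nonneg _) (norm_nonneg _)
  calc dist (ι x + latticeVec (fun j => ⌊ι' 0 j⌋ - ⌊ι 0 j⌋)) (ι' x)
      = ‖o + ∑ i, x i • (v i - v' i)‖ := by
        rw [dist_eq_norm, isometryEquiv_apply_eq_add_sum ι x, isometryEquiv_apply_eq_add_sum ι' x]
        simp only [smul_sub _ (v _), Finset.sum_sub_distrib, o]
        congr 1
        abel
    _ ≤ Fintype.card κ * ε + Fintype.card κ • (‖x‖ * (Fintype.card κ * ε)) :=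
        (norm_add_le _ _).trans (add_le_add ho ((norm_sum_le _ _).trans
          (Finset.sum_le_card_nsmul _ _ _ fun i _ => hterm i)))
    _ = Fintype.card κ * ε * (1 + Fintype.card κ * ‖x‖) := by
        rw [nsmul_eq_mul]
        ring

end Data

lemma exists_finset_isometry_net {K : ℕ} (hK : 0 < K) :
    ∃ S : Finset (EuclideanSpace ℝ κ ≃ᵢ EuclideanSpace ℝ κ),
      S.card ≤ (2 * K + 1) ^ ((Fintype.card κ + 1) * Fintype.card κ) ∧
      ∀ ι : EuclideanSpace ℝ κ ≃ᵢ EuclideanSpace ℝ κ, ∃ ι' ∈ S, ∃ z : κ → ℤ, ∀ x,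
        dist (ι x + latticeVec z) (ι' x) ≤
          Fintype.card κ * (1 / K) * (1 + Fintype.card κ * ‖x‖) := by
  classical
  obtain ⟨S, hcard, hS⟩ :=
    exists_finset_forall_abs_sub_le (abs_isometryData_le_one (κ := κ)) hK
  refine ⟨S, by simpa using hcard, fun ι => ?_⟩
  obtain ⟨ι', hι', hdata⟩ := hS ι
  exact ⟨ι', hι', exists_dist_add_latticeVec_le hdata⟩

lemma exists_finset_plane_isometry_net {τ : ℝ} (hτ : 0 < τ) (hτ1 : τ ≤ 1) :
    ∃ S : Finset (Plane ≃ᵢ Plane), (S.card : ℝ) ≤ (41 / τ) ^ 6 ∧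
      ∀ ι : Plane ≃ᵢ Plane, ∃ ι' ∈ S, ∃ z : Fin 2 → ℤ, ∀ x : Plane, ‖x‖ ≤ 4 →
        dist (ι x + latticeVec z) (ι' x) ≤ τ := by
  have hK : 18 / τ ≤ ⌈18 / τ⌉₊ := Nat.le_ceil _
  have hK0 : (0 : ℝ) < ⌈18 / τ⌉₊ := lt_of_lt_of_le (by positivity) hK
  obtain ⟨S, hcard, hS⟩ := exists_finset_isometry_net (κ := Fin 2) (Nat.cast_pos.1 hK0)
  refine ⟨S, ?_, fun ι => ?_⟩
  · have hone : 1 ≤ 1 / τ := (one_le_div hτ).2 hτ1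
    have hceil := (Nat.ceil_lt_add_one (show 0 ≤ 18 / τ by positivity)).le
    calc (S.card : ℝ) ≤ (2 * ⌈18 / τ⌉₊ + 1) ^ 6 := by exact_mod_cast hcard
      _ ≤ (41 / τ) ^ 6 := by
          gcongr
          linarith [show 41 / τ = 2 * (18 / τ) + 5 * (1 / τ) by ring]
  · obtain ⟨ι', hι', z, hz⟩ := hS ι
    refine ⟨ι', hι', z, fun x hx => (hz x).trans ?_⟩
    rw [div_le_iff₀ hτ] at hK
    calc (Fintype.card (Fin 2) : ℝ) * (1 / ⌈18 / τ⌉₊) * (1 + Fintype.card (Fin 2) * ‖x‖)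
        ≤ 2 * (1 / ⌈18 / τ⌉₊) * (1 + 2 * 4) := by
          simp only [Fintype.card_fin, Nat.cast_ofNat]
          gcongr
      _ = 18 / ⌈18 / τ⌉₊ := by ring
      _ ≤ τ := by
          rw [div_le_iff₀ hK0]
          linarith

end IsometryNet

section Refinement

lemma intervalIntegrable_ballDensity {E : Type*} [NormedAddCommGroup E] [NormedSpace ℝ E]
    [FiniteDimensional ℝ E] [MeasurableSpace E] [BorelSpace E] {μ : Measure E}
    [μ.IsAddHaarMeasure] {U : Set E} (hU : MeasurableSet U) (R : ℝ) {g : ℝ → E}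
    (hg : Measurable g) (a b : ℝ) :
    IntervalIntegrable (fun t => ballDensity μ U R (g t)) volume a b :=
  intervalIntegrable_of_mem_Icc_zero_one (measurable_ballDensity hU hg R)
    (fun _ => ballDensity_nonneg _ _ _ _) (fun _ => ballDensity_le_one _ _ _ _) a b

lemma integral_ballDensity_le_of_dist_add_latticeVec_le {κ : Type*} [Fintype κ]
    {U : Set (EuclideanSpace ℝ κ)} (hU : MeasurableSet U) (hper : IsLatticePeriodic U)
    {g g' : ℝ → EuclideanSpace ℝ κ} (hg : Measurable g) (hg' : Measurable g') {r s : ℝ}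
    (hr : 0 < r) {z : κ → ℤ}
    (hdist : ∀ t ∈ Set.Icc (0 : ℝ) 1, dist (g t + latticeVec z) (g' t) ≤ s * r) :
    ∫ t in (0 : ℝ)..1, ballDensity volume U r (g t) ≤
      (1 + s) ^ Fintype.card κ * ∫ t in (0 : ℝ)..1, ballDensity volume U ((1 + s) * r) (g' t) := by
  rw [← intervalIntegral.integral_const_mul]
  refine intervalIntegral.integral_mono_on zero_le_one
    (intervalIntegrable_ballDensity hU _ hg _ _)
    ((intervalIntegrable_ballDensity hU _ hg' _ _).const_mul _) fun t ht => ?_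
  have hball : dist (g t + latticeVec z) (g' t) + r ≤ (1 + s) * r := by linarith [hdist t ht]
  have hle := ballDensity_le_of_dist_add_le (μ := volume) (U := U) hr hball
  rwa [ballDensity_add_latticeVec hper, finrank_euclideanSpace, mul_div_cancel_right₀ _ hr.ne']
    at hle

lemma exists_forall_integral_ballDensity_add_plateauSum_le {E : Type*} [NormedAddCommGroup E]
    [NormedSpace ℝ E] [FiniteDimensional ℝ E] [MeasurableSpace E] [BorelSpace E] {μ : Measure E}
    [μ.IsAddHaarMeasure] {U : Set E} (hU : MeasurableSet U) {f : ℝ → E} (hf : Measurable f)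
    {R r s θ : ℝ} (hR : 0 < R) (hr : 0 < r) (hrR : R / (1 + s) + r ≤ R) (hs : 0 < s) (hs1 : s ≤ 1)
    (S : Finset (E ≃ᵢ E)) {N : ℕ} (hN : 0 < N) (hθ : 0 < θ) (hθ1 : θ ≤ 1 / 2) :
    ∃ ω : ℕ → E, (∀ i, ‖ω i‖ ≤ R) ∧ ∀ ι ∈ S,
      ∫ t in (0 : ℝ)..1, ballDensity μ U r (ι (f t + plateauSum N θ ω t)) ≤
        (1 + s) ^ (Module.finrank ℝ E + 1) * (∫ t in (0 : ℝ)..1, ballDensity μ U R (ι (f t))) +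
          Real.log S.card / (s * N) + 2 * θ := by
  have hρ : 0 < R / (1 + s) := by positivity
  have hG (ι : E ≃ᵢ E) (a b : ℝ) : IntervalIntegrable
      (fun t => (1 + s) ^ Module.finrank ℝ E * ballDensity μ U R (ι (f t))) volume a b :=
    (intervalIntegrable_ballDensity hU R (ι.continuous.measurable.comp hf) a b).const_mul _
  have hFG (ι : E ≃ᵢ E) (x : E) : ⨍ ω in ball 0 (R / (1 + s)), ballDensity μ U r (ι (x + ω)) ∂μ ≤
      (1 + s) ^ Module.finrank ℝ E * ballDensity μ U R (ι x) := by
    have hmean := setAverage_ballDensity_le (μ := μ) hU hρ hr hrR ι x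
    rwa [div_div_cancel₀ hR.ne'] at hmean
  obtain ⟨ω, hω, hle⟩ := exists_forall_integral_add_plateauSum_le
    (F := fun (ι : E ≃ᵢ E) x => ballDensity μ U r (ι x))
    (G := fun (ι : E ≃ᵢ E) x => (1 + s) ^ Module.finrank ℝ E * ballDensity μ U R (ι x))
    (measure_ball_pos μ (0 : E) hρ).ne' measure_ball_lt_top.ne S
    (fun ι => measurable_ballDensity hU ι.continuous.measurable r)
    (fun _ _ => ballDensity_nonneg _ _ _ _) (fun _ _ => ballDensity_le_one _ _ _ _) hf hG hFG
    hN hθ hθ1 hs hs1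
  refine ⟨ω, fun i => (mem_ball_zero_iff.1 (hω i)).le.trans (by linarith), fun ι hι => ?_⟩
  have hι := hle ι hι
  rw [intervalIntegral.integral_const_mul, ← mul_assoc, ← pow_succ'] at hι
  exact hι

lemma integral_ballDensity_add_le_of_net {U : Set Plane} (hU : MeasurableSet U)
    (hper : IsLatticePeriodic U) {g : ℝ → Plane} (hg : Measurable g)
    (hg4 : ∀ t ∈ Set.Icc (0 : ℝ) 1, ‖g t‖ ≤ 4) {S : Finset (Plane ≃ᵢ Plane)} {r s C : ℝ}
    (hr : 0 < r)
    (hnet : ∀ ι : Plane ≃ᵢ Plane, ∃ ι' ∈ S, ∃ z : Fin 2 → ℤ, ∀ x : Plane, ‖x‖ ≤ 4 →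
      dist (ι x + latticeVec z) (ι' x) ≤ s * r)
    (hC : ∀ ι ∈ S, ∫ t in (0 : ℝ)..1, ballDensity volume U ((1 + s) * r) (ι (g t)) ≤ C)
    (ι : Plane ≃ᵢ Plane) :
    ∫ t in (0 : ℝ)..1, ballDensity volume U r (ι (g t)) ≤ (1 + s) ^ 2 * C := by
  obtain ⟨ι', hι', z, hz⟩ := hnet ι
  calc ∫ t in (0 : ℝ)..1, ballDensity volume U r (ι (g t))
      ≤ (1 + s) ^ 2 * ∫ t in (0 : ℝ)..1, ballDensity volume U ((1 + s) * r) (ι' (g t)) :=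
        integral_ballDensity_le_of_dist_add_latticeVec_le hU hper
          (ι.continuous.measurable.comp hg) (ι'.continuous.measurable.comp hg) hr
          fun t ht => hz _ (hg4 t ht)
    _ ≤ (1 + s) ^ 2 * C := mul_le_mul_of_nonneg_left (hC ι' hι') (sq_nonneg _)

lemma exists_refinement {U : Set Plane} (hU : MeasurableSet U) (hper : IsLatticePeriodic U)
    {f : ℝ → Plane} (hf : Measurable f) (hf3 : ∀ t ∈ Set.Icc (0 : ℝ) 1, ‖f t‖ ≤ 3) {R r s d η : ℝ}
    {N : ℕ} (hR : 0 < R) (hR1 : R ≤ 1) (hr : 0 < r) (hrR : 4 * r ≤ s * R) (hs : 0 < s)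
    (hs1 : s ≤ 1) (hd : 0 < d) (hd1 : d ≤ 1) (hN : 0 < N)
    (hlog : 12 * Real.log (41 / (s * r)) ≤ s * d * N)
    (hη : ∀ ι : Plane ≃ᵢ Plane, ∫ t in (0 : ℝ)..1, ballDensity volume U R (ι (f t)) ≤ η) :
    ∃ u : ℝ → Plane, u 0 = 0 ∧ (∀ t, ‖u t‖ ≤ R) ∧
      (∀ t t', ‖u t - u t'‖ ≤ 8 * R * N / d * |t - t'|) ∧
      ∀ ι : Plane ≃ᵢ Plane, ∫ t in (0 : ℝ)..1, ballDensity volume U r (ι (f t + u t)) ≤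
        (1 + s) ^ 5 * (η + d) := by
  have hτ1 : s * r ≤ 1 := by nlinarith
  have hscale : R / (1 + s) + (1 + s) * r ≤ R := by
    rw [← le_sub_iff_add_le', sub_div' (by positivity), le_div_iff₀ (by positivity)]
    nlinarith [show (1 + s) * (1 + s) ≤ 4 by nlinarith]
  obtain ⟨S, hcard, hnet⟩ := exists_finset_plane_isometry_net (mul_pos hs hr) hτ1
  have hentropy : Real.log S.card / (s * N) ≤ d / 2 := by
    obtain ⟨ι', hι', -⟩ := hnet (IsometryEquiv.refl _)
    have hmono := Real.log_le_log (Nat.cast_pos.2 (Finset.card_pos.2 ⟨ι', hι'⟩)) hcard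
    rw [Real.log_pow] at hmono
    rw [div_le_iff₀ (by positivity)]
    push_cast at hmono
    linarith
  obtain ⟨ω, hω, hle⟩ := exists_forall_integral_ballDensity_add_plateauSum_le (μ := volume) hU hf
    hR (by positivity) hscale hs hs1 S hN (θ := d / 4) (by positivity) (by linarith)
  rw [finrank_euclideanSpace_fin] at hle
  have hu := norm_plateauSum_le (θ := d / 4) (by positivity) N hω
  refine ⟨plateauSum N (d / 4) ω, plateauSum_zero (by positivity) N ω, hu, fun t t' => ?_,
    fun ι => ?_⟩
  · refine (norm_plateauSum_sub_le (by positivity) N hω t t').trans_eq ?_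
    field_simp
    ring
  · refine (integral_ballDensity_add_le_of_net hU hper
      (hf.add (continuous_plateauSum N (d / 4) ω).measurable)
      (fun t ht => (norm_add_le _ _).trans (by linarith [hf3 t ht, hu t])) hr hnet
      (C := (1 + s) ^ 3 * (η + d)) (fun ι' hι' => (hle ι' hι').trans ?_) ι).trans_eq (by ring)
    have hmono := mul_le_mul_of_nonneg_left (hη ι') (show 0 ≤ (1 + s) ^ 3 by positivity)
    have hpow : 1 ≤ (1 + s) ^ 3 := one_le_pow₀ (by linarith)
    nlinarith

end Refinement

section Stages

/-- The scale `R` is small enough, in terms of the step parameter `s` and the error `d`, for a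
refinement with relative loss `s` to exist. The constants are `10496 = 41 * 256`, where `41` comes
from the isometry net and `256` from the ratio of successive scales, and `208 = 16 * 13`. -/
structure IsAdmissibleScale (d s R : ℝ) : Prop where
  scale_pos : 0 < R
  scale_le : R ≤ s
  step_le_one : s ≤ 1
  mul_log_le : 208 * R * Real.log (10496 / (s ^ 2 * R)) ≤ (d * s ^ 2) ^ 2

variable {U : Set Plane} {η d s R : ℝ}

lemma IsAdmissibleScale.step_pos (h : IsAdmissibleScale d s R) : 0 < s :=
  h.scale_pos.trans_le h.scale_le

lemma IsAdmissibleScale.one_le_log (h : IsAdmissibleScale d s R) :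
    1 ≤ Real.log (10496 / (s ^ 2 * R)) := by
  have hs := h.step_pos
  have hR := h.scale_pos
  have hle : s ^ 2 * R ≤ 1 :=
    mul_le_one₀ (pow_le_one₀ hs.le h.step_le_one) hR.le (h.scale_le.trans h.step_le_one)
  rw [Real.le_log_iff_exp_le (by positivity), le_div_iff₀ (by positivity)]
  nlinarith [Real.exp_one_lt_three, Real.exp_pos 1]

lemma IsAdmissibleScale.next (h : IsAdmissibleScale d s R) :
    IsAdmissibleScale d (s / 2) (s * R / 256) := by
  have hs := h.step_pos
  have hs1 := h.step_le_one
  have hR := h.scale_pos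
  have hL := h.one_le_log
  refine ⟨by positivity, by nlinarith [h.scale_le], by linarith, ?_⟩
  have hlog : Real.log (10496 / ((s / 2) ^ 2 * (s * R / 256))) ≤
      Real.log (10496 / (s ^ 2 * R)) + (10 + 1 / s) := by
    have hsplit : 10496 / ((s / 2) ^ 2 * (s * R / 256)) =
        10496 / (s ^ 2 * R) * (2 ^ 10 * (1 / s)) := by
      field_simp
      norm_num
    rw [hsplit, Real.log_mul (by positivity) (by positivity),
      Real.log_mul (by positivity) (by positivity), Real.log_pow]
    gcongr
    · push_cast
      linarith [Real.log_two_lt_d9]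
    · exact Real.log_le_self (by positivity)
  have hmul : s * (Real.log (10496 / (s ^ 2 * R)) + (10 + 1 / s)) ≤
      16 * Real.log (10496 / (s ^ 2 * R)) := by
    rw [mul_add, mul_add, mul_one_div_cancel hs.ne']
    nlinarith
  calc 208 * (s * R / 256) * Real.log (10496 / ((s / 2) ^ 2 * (s * R / 256)))
      ≤ 208 * (s * R / 256) * (Real.log (10496 / (s ^ 2 * R)) + (10 + 1 / s)) := by gcongr
    _ = 208 * R / 256 * (s * (Real.log (10496 / (s ^ 2 * R)) + (10 + 1 / s))) := by ring
    _ ≤ 208 * R / 256 * (16 * Real.log (10496 / (s ^ 2 * R))) := by gcongr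
    _ = 208 * R * Real.log (10496 / (s ^ 2 * R)) / 16 := by ring
    _ ≤ (d * s ^ 2) ^ 2 / 16 := by gcongr; exact h.mul_log_le
    _ = (d * (s / 2) ^ 2) ^ 2 := by ring

lemma IsAdmissibleScale.exists_nat (h : IsAdmissibleScale d s R) (hd : 0 < d) (hd1 : d ≤ 1) :
    ∃ N : ℕ, 0 < N ∧ 12 * Real.log (41 / (s * (s * R / 256))) ≤ s * (d * s) * N ∧
      8 * R * N / (d * s) ≤ s / 2 := by
  have hs := h.step_pos
  have hR := h.scale_pos
  have hL := h.one_le_log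
  have hmul := h.mul_log_le
  have hrw : 41 / (s * (s * R / 256)) = 10496 / (s ^ 2 * R) := by
    field_simp
    norm_num
  rw [hrw]
  set L := Real.log (10496 / (s ^ 2 * R))
  have hds : d * s ^ 2 ≤ 1 := mul_le_one₀ hd1 (by positivity) (pow_le_one₀ hs.le h.step_le_one)
  refine ⟨⌈12 * L / (d * s ^ 2)⌉₊, Nat.ceil_pos.2 (by positivity), ?_, ?_⟩
  · have hle := Nat.le_ceil (12 * L / (d * s ^ 2))
    rw [div_le_iff₀ (by positivity)] at hle
    linarith
  · have hceil : (⌈12 * L / (d * s ^ 2)⌉₊ : ℝ) ≤ 13 * L / (d * s ^ 2) := by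
      refine (Nat.ceil_lt_add_one (by positivity)).le.trans ?_
      rw [div_add_one (by positivity)]
      gcongr
      linarith
    calc 8 * R * ⌈12 * L / (d * s ^ 2)⌉₊ / (d * s)
        ≤ 8 * R * (13 * L / (d * s ^ 2)) / (d * s) := by gcongr
      _ = 208 * R * L / (2 * d ^ 2 * s ^ 3) := by
          field_simp
          norm_num
      _ ≤ (d * s ^ 2) ^ 2 / (2 * d ^ 2 * s ^ 3) := by gcongr
      _ = s / 2 := by field_simp

/-- A curve obtained from a straight segment of length `2` after finitely many refinements, the
last of which had step parameter `2 * s` and led to the scale `R`. The factor `2 - 2 * s` is the sum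
of all step parameters used so far. -/
structure IsStage (U : Set Plane) (η d s R : ℝ) (f : ℝ → Plane) : Prop
    extends IsAdmissibleScale d s R where
  map_zero : f 0 = 0
  le_dist : ∀ t u, (1 + s) * |t - u| ≤ dist (f t) (f u)
  dist_le : ∀ t u, dist (f t) (f u) ≤ (3 - s) * |t - u|
  integral_le : ∀ ι : Plane ≃ᵢ Plane, ∫ t in (0 : ℝ)..1, ballDensity volume U R (ι (f t)) ≤
    Real.exp (5 * (2 - 2 * s)) * (η + d * (2 - 2 * s))

variable {f : ℝ → Plane}

lemma IsStage.lipschitzWith (h : IsStage U η d s R f) : LipschitzWith 3 f :=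
  LipschitzWith.of_dist_le_mul fun t u => (h.dist_le t u).trans <|
    mul_le_mul_of_nonneg_right (by push_cast; linarith [h.step_pos]) (abs_nonneg _)

lemma IsStage.antilipschitzWith (h : IsStage U η d s R f) : AntilipschitzWith 1 f :=
  AntilipschitzWith.of_le_mul_dist fun t u => by
    rw [NNReal.coe_one, one_mul]
    exact (le_mul_of_one_le_left (abs_nonneg _) (by linarith [h.step_pos])).trans (h.le_dist t u)

lemma IsStage.norm_le (h : IsStage U η d s R f) {t : ℝ} (ht : t ∈ Set.Icc (0 : ℝ) 1) :
    ‖f t‖ ≤ 3 := by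
  have hdist := h.lipschitzWith.dist_le_mul t 0
  rw [h.map_zero, dist_zero_right, dist_zero_right, Real.norm_of_nonneg ht.1] at hdist
  push_cast at hdist
  linarith [ht.2]

lemma one_add_pow_mul_exp_add_le {σ : ℝ} (hη : 0 ≤ η) (hd : 0 ≤ d) (hσ : 0 ≤ σ) (hs : 0 ≤ s) :
    (1 + s) ^ 5 * (Real.exp (5 * σ) * (η + d * σ) + d * s) ≤
      Real.exp (5 * (σ + s)) * (η + d * (σ + s)) := by
  have hpow : (1 + s) ^ 5 ≤ Real.exp (5 * s) := by
    calc (1 + s) ^ 5 ≤ Real.exp s ^ 5 := by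
          gcongr
          linarith [Real.add_one_le_exp s]
      _ = Real.exp (5 * s) := by rw [← Real.exp_nat_mul]; norm_num
  have herror : d * s ≤ Real.exp (5 * σ) * (d * s) :=
    le_mul_of_one_le_left (by positivity) (Real.one_le_exp (by positivity))
  calc (1 + s) ^ 5 * (Real.exp (5 * σ) * (η + d * σ) + d * s)
      ≤ Real.exp (5 * s) * (Real.exp (5 * σ) * (η + d * σ) + Real.exp (5 * σ) * (d * s)) := by
        gcongr
    _ = Real.exp (5 * (σ + s)) * (η + d * (σ + s)) := by
        rw [mul_add 5, Real.exp_add]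
        ring

lemma IsStage.exists_next (h : IsStage U η d s R f) (hU : MeasurableSet U)
    (hper : IsLatticePeriodic U) (hη : 0 ≤ η) (hd : 0 < d) (hd1 : d ≤ 1) :
    ∃ g, IsStage U η d (s / 2) (s * R / 256) g ∧ ∀ t, dist (f t) (g t) ≤ s := by
  have hs := h.step_pos
  have hs1 := h.step_le_one
  have hR := h.scale_pos
  obtain ⟨N, hN, hlog, hlip⟩ := h.exists_nat hd hd1
  obtain ⟨u, hu0, hu, hulip, huint⟩ := exists_refinement hU hper
    h.lipschitzWith.continuous.measurable (fun t => h.norm_le) hR (h.scale_le.trans hs1)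
    (by positivity) (by nlinarith) hs hs1 (by positivity) (mul_le_one₀ hd1 hs.le hs1) hN hlog
    h.integral_le
  have hulip' (t t' : ℝ) : ‖u t - u t'‖ ≤ s / 2 * |t - t'| :=
    (hulip t t').trans (mul_le_mul_of_nonneg_right hlip (abs_nonneg _))
  refine ⟨fun t => f t + u t, ⟨h.next, by simp [h.map_zero, hu0], fun t t' => ?_, fun t t' => ?_,
    fun ι => ?_⟩, fun t => ?_⟩
  · have hsub := norm_sub_le_norm_add (f t - f t') (u t - u t')
    have hle := h.le_dist t t'
    rw [dist_eq_norm] at hle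
    rw [dist_eq_norm, add_sub_add_comm]
    linarith [hulip' t t']
  · linarith [dist_add_add_le (f t) (u t) (f t') (u t'), h.dist_le t t', hulip' t t',
      dist_eq_norm (u t) (u t')]
  · rw [show 2 - 2 * (s / 2) = (2 - 2 * s) + s by ring]
    exact (huint ι).trans (one_add_pow_mul_exp_add_le hη hd.le (by linarith) hs.le)
  · rw [dist_self_add_right]
    exact (hu t).trans h.scale_le

lemma IsStage.exists_seq (h : IsStage U η d 1 R f) (hU : MeasurableSet U)
    (hper : IsLatticePeriodic U) (hη : 0 ≤ η) (hd : 0 < d) (hd1 : d ≤ 1) :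
    ∃ (r : ℕ → ℝ) (g : ℕ → ℝ → Plane), (∀ j, IsStage U η d (1 / 2 ^ j) (r j) (g j)) ∧
      ∀ j t, dist (g j t) (g (j + 1) t) ≤ 1 / 2 ^ j := by
  have hnext (j : ℕ) (x : {x : ℝ × (ℝ → Plane) // IsStage U η d (1 / 2 ^ j) x.1 x.2}) :
      ∃ y : {x : ℝ × (ℝ → Plane) // IsStage U η d (1 / 2 ^ (j + 1)) x.1 x.2},
        ∀ t, dist (x.1.2 t) (y.1.2 t) ≤ 1 / 2 ^ j := by
    obtain ⟨g, hg, hdist⟩ := x.2.exists_next hU hper hη hd hd1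
    rw [div_div, ← pow_succ] at hg
    exact ⟨⟨(_, g), hg⟩, hdist⟩
  choose F hF using hnext
  let x : ∀ j, {x : ℝ × (ℝ → Plane) // IsStage U η d (1 / 2 ^ j) x.1 x.2} :=
    fun j => Nat.rec ⟨(R, f), by simpa using h⟩ F j
  exact ⟨fun j => (x j).1.1, fun j => (x j).1.2, fun j => (x j).2, fun j => hF j (x j)⟩

end Stages

section Limit

lemma indicator_one_preimage_le_liminf_ballDensity {X T : Type*} [PseudoMetricSpace X]
    [ProperSpace X] [MeasurableSpace X] {μ : Measure X} [IsFiniteMeasureOnCompacts μ]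
    [μ.IsOpenPosMeasure] {U : Set X} (hU : IsOpen U) {g : ℕ → T → X} {g₀ : T → X} {t : T}
    (hg : Tendsto (fun j => g j t) atTop (𝓝 (g₀ t))) {R : ℕ → ℝ} (hR : ∀ j, 0 < R j)
    (hR₀ : Tendsto R atTop (𝓝 0)) :
    (g₀ ⁻¹' U).indicator 1 t ≤
      liminf (fun j => ENNReal.ofReal (ballDensity μ U (R j) (g j t))) atTop := by
  by_cases ht : t ∈ g₀ ⁻¹' U
  · rw [Set.indicator_of_mem ht]
    refine le_liminf_of_le (by isBoundedDefault) ?_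
    obtain ⟨ε, hε, hball⟩ := Metric.isOpen_iff.1 hU _ ht
    filter_upwards [Metric.tendsto_nhds.1 hg (ε / 2) (half_pos hε),
      hR₀.eventually_lt_const (half_pos hε)] with j hdist hRj
    rw [ballDensity_eq_one_of_ball_subset (hR j)
      ((ball_subset_ball' (by linarith)).trans hball), ENNReal.ofReal_one, Pi.one_apply]
  · rw [Set.indicator_of_notMem ht]
    exact zero_le

lemma measure_preimage_le_of_integral_ballDensity_le {X T : Type*} [PseudoMetricSpace X]
    [ProperSpace X] [MeasurableSpace X] [BorelSpace X] [MeasurableSpace T] {μ : Measure X}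
    [IsFiniteMeasureOnCompacts μ] [SFinite μ] [μ.IsOpenPosMeasure] {ν : Measure T}
    [IsFiniteMeasure ν] {U : Set X} (hU : IsOpen U) {g : ℕ → T → X} {g₀ : T → X}
    (hg : ∀ j, Measurable (g j)) (hg₀ : ∀ t, Tendsto (fun j => g j t) atTop (𝓝 (g₀ t))) {R : ℕ → ℝ}
    (hR : ∀ j, 0 < R j) (hR₀ : Tendsto R atTop (𝓝 0)) {B : ℝ}
    (hB : ∀ j, ∫ t, ballDensity μ U (R j) (g j t) ∂ν ≤ B) :
    ν (g₀ ⁻¹' U) ≤ ENNReal.ofReal B := by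
  have hm (j : ℕ) : Measurable fun t => ballDensity μ U (R j) (g j t) :=
    measurable_ballDensity hU.measurableSet (hg j) (R j)
  have hlintegral (j : ℕ) :
      ∫⁻ t, ENNReal.ofReal (ballDensity μ U (R j) (g j t)) ∂ν ≤ ENNReal.ofReal B := by
    have hint : Integrable (fun t => ballDensity μ U (R j) (g j t)) ν :=
      Integrable.of_bound (hm j).aestronglyMeasurable 1 <| .of_forall fun t => by
        rw [Real.norm_of_nonneg (ballDensity_nonneg _ _ _ _)]
        exact ballDensity_le_one _ _ _ _
    rw [← ofReal_integral_eq_lintegral_ofReal hint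
      (.of_forall fun t => ballDensity_nonneg _ _ _ _)]
    exact ENNReal.ofReal_le_ofReal (hB j)
  have hmeas : MeasurableSet (g₀ ⁻¹' U) :=
    measurable_of_tendsto_metrizable hg (tendsto_pi_nhds.2 hg₀) hU.measurableSet
  calc ν (g₀ ⁻¹' U) = ∫⁻ t, (g₀ ⁻¹' U).indicator 1 t ∂ν := (lintegral_indicator_one hmeas).symm
    _ ≤ ∫⁻ t, liminf (fun j => ENNReal.ofReal (ballDensity μ U (R j) (g j t))) atTop ∂ν :=
        lintegral_mono fun t => indicator_one_preimage_le_liminf_ballDensity hU (hg₀ t) hR hR₀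
    _ ≤ liminf (fun j => ∫⁻ t, ENNReal.ofReal (ballDensity μ U (R j) (g j t)) ∂ν) atTop :=
        lintegral_liminf_le fun j => (hm j).ennreal_ofReal
    _ ≤ liminf (fun _ : ℕ => ENNReal.ofReal B) atTop :=
        liminf_le_liminf (.of_forall hlintegral)
    _ = ENNReal.ofReal B := liminf_const _

variable {U : Set Plane} {η d R : ℝ} {f : ℝ → Plane}

lemma IsStage.integral_le_exp_ten_mul {s : ℝ} (h : IsStage U η d s R f) (hη : 0 ≤ η) (hd : 0 ≤ d)
    (ι : Plane ≃ᵢ Plane) :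
    ∫ t in Set.Icc (0 : ℝ) 1, ballDensity volume U R (ι (f t)) ≤ Real.exp 10 * (η + 2 * d) := by
  have hs := h.step_pos
  have hle := h.integral_le ι
  rw [intervalIntegral.integral_of_le zero_le_one, ← integral_Icc_eq_integral_Ioc] at hle
  refine hle.trans (mul_le_mul (Real.exp_le_exp.2 (by linarith)) ?_ ?_ (Real.exp_nonneg _))
  · nlinarith
  · have : 0 ≤ d * (2 - 2 * s) := mul_nonneg hd (by linarith [h.step_le_one])
    positivity

lemma IsStage.exists_curve (h : IsStage U η d 1 R f) (hU : IsOpen U) (hper : IsLatticePeriodic U)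
    (hη : 0 ≤ η) (hd : 0 < d) (hd1 : d ≤ 1) :
    ∃ g : ℝ → Plane, LipschitzWith 3 g ∧ AntilipschitzWith 1 g ∧ ∀ ι : Plane ≃ᵢ Plane,
      volume (Set.Icc 0 1 ∩ (fun t => ι (g t)) ⁻¹' U) ≤
        ENNReal.ofReal (Real.exp 10 * (η + 2 * d)) := by
  obtain ⟨r, f, hf, hdist⟩ := h.exists_seq hU.measurableSet hper hη hd hd1
  have hlim (t : ℝ) : ∃ y, Tendsto (fun j => f j t) atTop (𝓝 y) :=
    cauchySeq_tendsto_of_complete <|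
      cauchySeq_of_le_geometric_two (C := 2) fun j => by simpa using hdist j t
  choose g hg using hlim
  have hdist_lim (t u : ℝ) : Tendsto (fun j => dist (f j t) (f j u)) atTop (𝓝 (dist (g t) (g u))) :=
    (hg t).dist (hg u)
  refine ⟨g,
    LipschitzWith.of_dist_le_mul fun t u => le_of_tendsto' (hdist_lim t u) fun j =>
      (hf j).lipschitzWith.dist_le_mul t u,
    AntilipschitzWith.of_le_mul_dist fun t u => ge_of_tendsto' ((hdist_lim t u).const_mul _)
      fun j => (hf j).antilipschitzWith.le_mul_dist t u, fun ι => ?_⟩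
  have hr : Tendsto r atTop (𝓝 0) :=
    squeeze_zero (fun j => (hf j).scale_pos.le) (fun j => (hf j).scale_le) <| by
      simpa using tendsto_pow_atTop_nhds_zero_of_lt_one (r := (1 / 2 : ℝ)) (by norm_num)
        (by norm_num)
  rw [Set.inter_comm, ← Measure.restrict_apply' measurableSet_Icc]
  exact measure_preimage_le_of_integral_ballDensity_le hU
    (fun j => ι.continuous.measurable.comp (hf j).lipschitzWith.continuous.measurable)
    (fun t => (ι.continuous.tendsto _).comp (hg t)) (fun j => (hf j).scale_pos) hr
    (fun j => (hf j).integral_le_exp_ten_mul hη hd.le ι)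

lemma isStage_segment {M : ℝ} (h : IsAdmissibleScale d 1 R) (hU : MeasurableSet U) (hM0 : 0 ≤ M)
    (hM : ∀ a, volume (U ∩ ball a 3) ≤ ENNReal.ofReal M) :
    IsStage U (M / R) d 1 R fun t => (2 * t) • EuclideanSpace.single 0 1 := by
  have hdist (t u : ℝ) : dist ((2 * t) • EuclideanSpace.single 0 1 : Plane)
      ((2 * u) • EuclideanSpace.single 0 1) = 2 * |t - u| := by
    rw [dist_eq_norm, ← sub_smul, norm_smul, PiLp.norm_single, norm_one, mul_one, ← mul_sub,
      Real.norm_eq_abs, abs_mul, abs_two]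
  refine ⟨h, by simp, fun t u => ?_, fun t u => ?_, fun ι => ?_⟩
  · rw [hdist]
    norm_num
  · rw [hdist]
    norm_num
  · have hle := integral_ballDensity_le_div_of_antilipschitzWith hU h.scale_pos hM0
      (hM (ι ((2 * 0 : ℝ) • EuclideanSpace.single 0 1)))
      (γ := fun t => ι ((2 * t) • EuclideanSpace.single 0 1))
      (ι.continuous.measurable.comp (by fun_prop))
      (AntilipschitzWith.of_le_mul_dist fun t u => by
        rw [ι.dist_eq, hdist, NNReal.coe_one, one_mul, Real.dist_eq]
        linarith [abs_nonneg (t - u)])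
      fun t ht => by
        rw [ι.dist_eq, hdist, sub_zero, abs_of_pos ht.1]
        linarith [ht.2, h.scale_le]
    simpa using hle

lemma exists_curve_volume_preimage_le {V : Set Plane} (hV : IsOpen V) {M : ℝ} (hM0 : 0 ≤ M)
    (hM : 49 * volume V ≤ ENNReal.ofReal M) (hd : 0 < d) (hd1 : d ≤ 1)
    (hR : IsAdmissibleScale d 1 R) :
    ∃ g : ℝ → Plane, LipschitzWith 3 g ∧ AntilipschitzWith 1 g ∧ ∀ ι : Plane ≃ᵢ Plane,
      volume (Set.Icc 0 1 ∩ (fun t => ι (g t)) ⁻¹' V) ≤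
        ENNReal.ofReal (Real.exp 10 * (M / R + 2 * d)) := by
  have hU := isOpen_periodization hV
  have hvolume (a : Plane) : volume (periodization V ∩ ball a 3) ≤ ENNReal.ofReal M := by
    have hle := volume_periodization_inter_ball_le hV.measurableSet a 3
    norm_num at hle
    exact hle.trans hM
  obtain ⟨g, hg, hg', hvol⟩ := (isStage_segment hR hU.measurableSet hM0 hvolume).exists_curve hU
    (isLatticePeriodic_periodization V) (div_nonneg hM0 hR.scale_pos.le) hd hd1
  refine ⟨g, hg, hg', fun ι => (measure_mono ?_).trans (hvol ι)⟩
  exact Set.inter_subset_inter_right _ (Set.preimage_mono (subset_periodization V))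

end Limit

section Length

variable {X : Type*} [EMetricSpace X] [MeasurableSpace X] [BorelSpace X] {K : NNReal} {Γ : ℝ → X}

lemma hausdorffMeasure_one_image_le_of_lipschitzWith (hΓ : LipschitzWith K Γ)
    (s : Set ℝ) : μH[1] (Γ '' s) ≤ K * volume s := by
  simpa only [hausdorffMeasure_real, ENNReal.rpow_one] using
    hΓ.hausdorffMeasure_image_le zero_le_one s

lemma volume_le_hausdorffMeasure_one_image_of_antilipschitzWith (hΓ : AntilipschitzWith K Γ)
    (s : Set ℝ) : volume s ≤ K * μH[1] (Γ '' s) := by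
  simpa only [hausdorffMeasure_real, ENNReal.rpow_one] using
    hΓ.le_hausdorffMeasure_image zero_le_one s

lemma hausdorffMeasure_one_image_Icc_ne_top (hΓ : LipschitzWith K Γ) (a b : ℝ) :
    μH[1] (Γ '' Set.Icc a b) ≠ ⊤ :=
  ne_top_of_le_ne_top (ENNReal.mul_ne_top ENNReal.coe_ne_top measure_Icc_lt_top.ne)
    (hausdorffMeasure_one_image_le_of_lipschitzWith hΓ _)

lemma lipschitzWith_hausdorffMeasure_one_image_Icc (hΓ : LipschitzWith K Γ) (a : ℝ) :
    LipschitzWith K fun T => (μH[1] (Γ '' Set.Icc a T)).toReal := by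
  refine LipschitzWith.of_le_add_mul K fun T S => ?_
  have hsubset : Γ '' Set.Icc a T ⊆ Γ '' Set.Icc a S ∪ Γ '' Set.Icc S T := by
    rw [← Set.image_union]
    refine Set.image_mono fun t ht => ?_
    rcases le_total t S with h | h
    exacts [Or.inl ⟨ht.1, h⟩, Or.inr ⟨h, ht.2⟩]
  have hpiece : (μH[1] (Γ '' Set.Icc S T)).toReal ≤ K * dist T S := by
    refine ENNReal.toReal_le_of_le_ofReal (by positivity) ?_
    rw [ENNReal.ofReal_mul K.coe_nonneg, ENNReal.ofReal_coe_nnreal]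
    refine (hausdorffMeasure_one_image_le_of_lipschitzWith hΓ _).trans ?_
    rw [Real.volume_Icc]
    gcongr
    exact le_abs_self _
  have hle := ENNReal.toReal_mono
    (ENNReal.add_ne_top.2 ⟨hausdorffMeasure_one_image_Icc_ne_top hΓ a S,
      hausdorffMeasure_one_image_Icc_ne_top hΓ S T⟩)
    ((measure_mono hsubset).trans (measure_union_le _ _))
  rw [ENNReal.toReal_add (hausdorffMeasure_one_image_Icc_ne_top hΓ a S)
    (hausdorffMeasure_one_image_Icc_ne_top hΓ S T)] at hle
  linarith

lemma exists_isUnitLengthCurve_image_Icc {Γ : ℝ → Plane} (hΓ : LipschitzWith K Γ)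
    (hΓ' : AntilipschitzWith 1 Γ) :
    ∃ T ∈ Set.Icc (0 : ℝ) 1, IsUnitLengthCurve (Γ '' Set.Icc 0 T) := by
  have hzero : (μH[1] (Γ '' Set.Icc 0 0)).toReal = 0 := by
    have hle := hausdorffMeasure_one_image_le_of_lipschitzWith hΓ (Set.Icc 0 0)
    simp_all
  have hone : 1 ≤ (μH[1] (Γ '' Set.Icc 0 1)).toReal := by
    have hle := volume_le_hausdorffMeasure_one_image_of_antilipschitzWith hΓ' (Set.Icc 0 1)
    rw [Real.volume_Icc, sub_zero, ENNReal.ofReal_one, ENNReal.coe_one, one_mul] at hle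
    simpa using ENNReal.toReal_mono (hausdorffMeasure_one_image_Icc_ne_top hΓ 0 1) hle
  obtain ⟨T, hT, hT1⟩ := intermediate_value_Icc zero_le_one
    (lipschitzWith_hausdorffMeasure_one_image_Icc hΓ 0).continuous.continuousOn
    ⟨hzero.trans_le zero_le_one, hone⟩
  have hT0 : 0 < T := hT.1.lt_of_ne fun h => by
    subst h
    exact zero_ne_one (hzero.symm.trans hT1)
  refine ⟨T, hT, ⟨fun x => Γ (T * x), ?_, ?_, ?_⟩, (ENNReal.toReal_eq_one_iff _).1 hT1⟩
  · exact (hΓ.continuous.comp (continuous_const_mul T)).continuousOn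
  · exact (hΓ'.injective.comp (mul_right_injective₀ hT0.ne')).injOn
  · rw [← Set.image_image Γ (T * ·), Set.image_mul_left_Icc hT0.le zero_le_one, mul_zero, mul_one]

lemma exists_isUnitLengthCurve_hausdorffMeasure_inter_preimage_le {V : Set Plane} (hV : IsOpen V)
    {M d R : ℝ} (hM0 : 0 ≤ M) (hM : 49 * volume V ≤ ENNReal.ofReal M) (hd : 0 < d) (hd1 : d ≤ 1)
    (hR : IsAdmissibleScale d 1 R) :
    ∃ γ, IsUnitLengthCurve γ ∧ ∀ ι : Plane ≃ᵢ Plane,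
      μH[1] (γ ∩ ι ⁻¹' V) ≤ ENNReal.ofReal (3 * (Real.exp 10 * (M / R + 2 * d))) := by
  obtain ⟨Γ, hΓ, hΓ', hvol⟩ := exists_curve_volume_preimage_le hV hM0 hM hd hd1 hR
  obtain ⟨T, hT, hγ⟩ := exists_isUnitLengthCurve_image_Icc hΓ hΓ'
  refine ⟨_, hγ, fun ι => ?_⟩
  calc μH[1] (Γ '' Set.Icc 0 T ∩ ι ⁻¹' V)
      ≤ μH[1] (Γ '' (Set.Icc 0 1 ∩ (fun t => ι (Γ t)) ⁻¹' V)) := by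
        rw [← Set.image_inter_preimage]
        exact measure_mono <| Set.image_mono <|
          Set.inter_subset_inter_left _ (Set.Icc_subset_Icc_right hT.2)
    _ ≤ 3 * volume (Set.Icc 0 1 ∩ (fun t => ι (Γ t)) ⁻¹' V) :=
        hausdorffMeasure_one_image_le_of_lipschitzWith hΓ _
    _ ≤ 3 * ENNReal.ofReal (Real.exp 10 * (M / R + 2 * d)) := by
        gcongr
        exact hvol ι
    _ = ENNReal.ofReal (3 * (Real.exp 10 * (M / R + 2 * d))) := by
        rw [ENNReal.ofReal_mul zero_le_three, ENNReal.ofReal_ofNat]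

end Length

section Constants

lemma exists_mul_log_div_add_le {c : ℝ} (hc : 0 < c) {a : ℝ} (ha : 0 < a) (b : ℝ) :
    ∃ K : ℝ, 0 < K ∧ K ≤ 1 ∧ K * (Real.log (a / K) + b) ≤ c := by
  have hcont : Continuous fun K => K * (Real.log a + b) - K * Real.log K :=
    (continuous_mul_const _).sub Real.continuous_mul_log
  have hlt : ∀ᶠ K in 𝓝 (0 : ℝ), K * (Real.log a + b) - K * Real.log K < c :=
    hcont.continuousAt.eventually_lt_const (by simpa using hc)
  obtain ⟨K, ⟨hKc, hK1⟩, hK0⟩ :=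
    (((hlt.and (eventually_lt_nhds one_pos)).filter_mono nhdsWithin_le_nhds).and
      self_mem_nhdsWithin : ∀ᶠ K in 𝓝[>] (0 : ℝ), _).exists
  refine ⟨K, hK0, hK1.le, ?_⟩
  rw [Real.log_div ha.ne' (ne_of_gt hK0)]
  linarith

lemma exists_isAdmissibleScale {c : ℝ} (hc : 0 < c) :
    ∃ K : ℝ, 0 < K ∧ ∀ δ : ℝ, 0 < δ → δ ≤ 1 →
      IsAdmissibleScale (c * δ) 1 (K * (δ ^ 2 / (1 - Real.log δ))) := by
  obtain ⟨K, hK0, hK1, hK⟩ := exists_mul_log_div_add_le (c := c ^ 2 / 208) (by positivity)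
    (a := 10496) (by norm_num) 3
  refine ⟨K, hK0, fun δ hδ hδ1 => ?_⟩
  have hL : 1 ≤ 1 - Real.log δ := by linarith [Real.log_nonpos hδ.le hδ1]
  have hL0 : 0 < 1 - Real.log δ := one_pos.trans_le hL
  refine ⟨by positivity, ?_, le_rfl, ?_⟩
  · exact mul_le_one₀ hK1 (by positivity)
      (div_le_one_of_le₀ ((pow_le_one₀ hδ.le hδ1).trans hL) hL0.le)
  have hK_log : 0 ≤ Real.log (10496 / K) :=
    Real.log_nonneg ((one_le_div hK0).2 (hK1.trans (by norm_num)))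
  have hlog : Real.log (10496 / (1 ^ 2 * (K * (δ ^ 2 / (1 - Real.log δ))))) ≤
      (Real.log (10496 / K) + 3) * (1 - Real.log δ) := by
    have hsplit : 10496 / (1 ^ 2 * (K * (δ ^ 2 / (1 - Real.log δ)))) =
        10496 / K * (1 - Real.log δ) / δ ^ 2 := by field_simp
    rw [hsplit, Real.log_div (by positivity) (by positivity),
      Real.log_mul (by positivity) hL0.ne', Real.log_pow]
    push_cast
    nlinarith [Real.log_le_sub_one_of_pos hL0]
  calc 208 * (K * (δ ^ 2 / (1 - Real.log δ))) *
        Real.log (10496 / (1 ^ 2 * (K * (δ ^ 2 / (1 - Real.log δ)))))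
      ≤ 208 * (K * (δ ^ 2 / (1 - Real.log δ))) *
          ((Real.log (10496 / K) + 3) * (1 - Real.log δ)) := by gcongr
    _ = 208 * δ ^ 2 * (K * (Real.log (10496 / K) + 3)) := by field_simp
    _ ≤ 208 * δ ^ 2 * (c ^ 2 / 208) := by gcongr
    _ = (c * δ * 1 ^ 2) ^ 2 := by ring

lemma exists_mul_rpow_le {p : ℝ} (hp : 3 < p) :
    ∃ C : ℝ, 0 < C ∧ ∀ δ : ℝ, 0 < δ → δ ≤ 1 → C * δ ^ p ≤ δ ^ 3 / (1 - Real.log δ) := by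
  have hε : 0 < p - 3 := sub_pos.2 hp
  refine ⟨(1 + 1 / (p - 3))⁻¹, by positivity, fun δ hδ hδ1 => ?_⟩
  have hL : 0 < 1 - Real.log δ := by linarith [Real.log_nonpos hδ.le hδ1]
  have hpow : δ ^ p = δ ^ 3 * δ ^ (p - 3) := by
    rw [← Real.rpow_natCast, ← Real.rpow_add hδ]
    norm_num
  have hlog : δ ^ (p - 3) * (1 - Real.log δ) ≤ 1 + 1 / (p - 3) := by
    have hle := Real.log_le_rpow_div (inv_nonneg.2 hδ.le) hε
    rw [Real.log_inv, Real.inv_rpow hδ.le] at hle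
    have hone : δ ^ (p - 3) ≤ 1 := Real.rpow_le_one hδ.le hδ1 hε.le
    calc δ ^ (p - 3) * (1 - Real.log δ) = δ ^ (p - 3) + δ ^ (p - 3) * -Real.log δ := by ring
      _ ≤ 1 + δ ^ (p - 3) * ((δ ^ (p - 3))⁻¹ / (p - 3)) := by gcongr
      _ = 1 + 1 / (p - 3) := by field_simp
  rw [le_div_iff₀ hL, hpow, inv_mul_eq_div, div_mul_eq_mul_div, div_le_iff₀ (by positivity),
    mul_assoc]
  gcongr

end Constants

theorem corollary2_general :
    ∃ c : ℝ, 0 < c ∧ ∀ δ : ℝ, 0 < δ → δ ≤ 1 → ∀ A : Set Plane,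
      (∀ γ, IsUnitLengthCurve γ →
        ∃ ι : Plane ≃ᵢ Plane, ENNReal.ofReal δ ≤ μH[1] (γ ∩ ι ⁻¹' A)) →
      ENNReal.ofReal (c * (δ ^ 3 / (1 - Real.log δ))) ≤ volume A := by
  have hexp : 1 ≤ Real.exp 10 := Real.one_le_exp (by norm_num)
  have hc1 : (10 * Real.exp 10)⁻¹ ≤ 1 := inv_le_one_of_one_le₀ (by linarith)
  obtain ⟨K, hK, hadm⟩ := exists_isAdmissibleScale (c := (10 * Real.exp 10)⁻¹) (by positivity)
  refine ⟨(10 * Real.exp 10)⁻¹ * K / 49, by positivity, fun δ hδ hδ1 A hA => ?_⟩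
  by_contra! hlt
  obtain ⟨V, hAV, hV, hVlt⟩ := Set.exists_isOpen_lt_of_lt _ _ hlt
  have hL : 0 < 1 - Real.log δ := by linarith [Real.log_nonpos hδ.le hδ1]
  have hM : 49 * volume V ≤
      ENNReal.ofReal (49 * ((10 * Real.exp 10)⁻¹ * K / 49 * (δ ^ 3 / (1 - Real.log δ)))) := by
    rw [ENNReal.ofReal_mul (by norm_num), ENNReal.ofReal_ofNat]
    gcongr
  obtain ⟨γ, hγ, hle⟩ := exists_isUnitLengthCurve_hausdorffMeasure_inter_preimage_le hV
    (by positivity) hM (by positivity) (mul_le_one₀ hc1 hδ.le hδ1) (hadm δ hδ hδ1)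
  obtain ⟨ι, hι⟩ := hA γ hγ
  have hδ_le := hι.trans ((measure_mono
    (Set.inter_subset_inter_right _ (Set.preimage_mono hAV))).trans (hle ι))
  rw [ENNReal.ofReal_le_ofReal_iff (by positivity)] at hδ_le
  have hval : 3 * (Real.exp 10 *
      (49 * ((10 * Real.exp 10)⁻¹ * K / 49 * (δ ^ 3 / (1 - Real.log δ))) /
        (K * (δ ^ 2 / (1 - Real.log δ))) + 2 * ((10 * Real.exp 10)⁻¹ * δ))) = 9 / 10 * δ := by
    field_simp
    norm_num
  linarith

theorem corollary2 (p : ℝ) (hp : 3 < p) :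
    ∃ c : ℝ, 0 < c ∧
      ∀ δ : ℝ, 0 < δ → δ ≤ 1 →
        ∀ (E : Set Plane → Set Plane) (ι : Set Plane → (Plane ≃ᵢ Plane)),
          (∀ γ : Set Plane, IsUnitLengthCurve γ →
            E γ ⊆ γ ∧ IsH1Measurable (E γ) ∧ ENNReal.ofReal δ ≤ μH[1] (E γ)) →
          ENNReal.ofReal (c * δ ^ p) ≤
            (volume : Measure Plane) (⋃ γ ∈ {γ : Set Plane | IsUnitLengthCurve γ}, ι γ '' E γ) := by
  obtain ⟨c, hc, hvol⟩ := corollary2_general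
  obtain ⟨C, hC, hpow⟩ := exists_mul_rpow_le hp
  refine ⟨c * C, mul_pos hc hC, fun δ hδ hδ1 E ι hE => ?_⟩
  refine (ENNReal.ofReal_le_ofReal ?_).trans (hvol δ hδ hδ1 _ fun γ hγ => ⟨ι γ, ?_⟩)
  · rw [mul_assoc]
    exact mul_le_mul_of_nonneg_left (hpow δ hδ hδ1) hc.le
  · exact (hE γ hγ).2.2.trans <| measure_mono fun x hx =>
      ⟨(hE γ hγ).1 hx, Set.mem_biUnion hγ (Set.mem_image_of_mem _ hx)⟩
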